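/- Let $0\le a_i<b_i$ for $i=1,2,3$, and assume that $$a_1b_2b_3+b_1a_2a_3\;\le\; b_1a_2b_3+a_1b_2a_3\;\le\; b_1b_2a_3+a_1a_2b_3 .$$ Points of $\mathbb{R}^4$ are written $(f,x_1,x_2,x_3)$. Let $P_1\subset\mathbb{R}^4$ be the solution set of the double-McCormick system of $f=x_1x_2x_3$ that groups $x_2,x_3$ first, that is, of the system obtained by Fourier–Motzkin elimination of $w$ from $$\begin{aligned} &w-a_3x_2-a_2x_3+a_2a_3\ge0, && -w+b_3x_2+a_2x_3-a_2b_3\ge0,\\ &-w+a_3x_2+b_2x_3-b_2a_3\ge0, && w-b_3x_2-b_2x_3+b_2b_3\ge0,\\ &f-a_1w-a_2a_3x_1+a_1a_2a_3\ge0, && -f+b_1w+a_2a_3x_1-b_1a_2a_3\ge0,\\ &-f+a_1w+b_2b_3x_1-a_1b_2b_3\ge0, && f-b_1w-b_2b_3x_1+b_1b_2b_3\ge0. \end{aligned}$$ Let $P_H\subset\mathbb{R}^4$ be the solution set of the following system $H$, where $\eta_1=b_1b_2a_3-a_1b_2b_3-b_1a_2a_3+b_1a_2b_3$ and $\eta_2=a_1a_2b_3-b_1a_2a_3-a_1b_2b_3+a_1b_2a_3$: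 $$\begin{aligned} &f-a_2a_3x_1-a_1a_3x_2-a_1a_2x_3+2a_1a_2a_3\ge0,\\ &f-b_2b_3x_1-b_1b_3x_2-b_1b_2x_3+2b_1b_2b_3\ge0,\\ &f-a_2b_3x_1-a_1b_3x_2-b_1a_2x_3+a_1a_2b_3+b_1a_2b_3\ge0,\\ &f-b_2a_3x_1-b_1a_3x_2-a_1b_2x_3+b_1b_2a_3+a_1b_2a_3\ge0,\\ &f-\tfrac{\eta_1}{b_1-a_1}x_1-b_1a_3x_2-b_1a_2x_3+\Big(\tfrac{\eta_1a_1}{b_1-a_1}+b_1b_2a_3+b_1a_2b_3-a_1b_2b_3\Big)\ge0,\\ &f-\tfrac{\eta_2}{a_1-b_1}x_1-a_1b_3x_2-a_1b_2x_3+\Big(\tfrac{\eta_2b_1}{a_1-b_1}+a_1a_2b_3+a_1b_2a_3-b_1a_2a_3\Big)\ge0,\\ &-f+a_2a_3x_1+b_1a_3x_2+b_1b_2x_3-b_1b_2a_3-b_1a_2a_3\ge0,\\ &-f+b_2a_3x_1+a_1a_3x_2+b_1b_2x_3-b_1b_2a_3-a_1b_2a_3\ge0,\\ &-f+a_2a_3x_1+b_1b_3x_2+b_1a_2x_3-b_1a_2b_3-b_1a_2a_3\ge0,\\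 &-f+b_2b_3x_1+a_1a_3x_2+a_1b_2x_3-a_1b_2b_3-a_1b_2a_3\ge0,\\ &-f+a_2b_3x_1+b_1b_3x_2+a_1a_2x_3-b_1a_2b_3-a_1a_2b_3\ge0,\\ &-f+b_2b_3x_1+a_1b_3x_2+a_1a_2x_3-a_1b_2b_3-a_1a_2b_3\ge0,\\ &a_i\le x_i\le b_i\quad(i=1,2,3). \end{aligned}$$ Let $v^1,\dots,v^8$ be the points $(x_1x_2x_3,x_1,x_2,x_3)$ with $x_i\in\{a_i,b_i\}$ for $i=1,2,3$. Put $D=b_2b_3-a_2a_3$ and $$\begin{aligned} v_1^{9}&=\Big(a_1a_2a_3+\tfrac{a_2(b_3-a_3)(b_1b_2b_3-a_1a_2a_3)}{D},\; a_1+\tfrac{a_2(b_1-a_1)(b_3-a_3)}{D},\; a_2,\; b_3\Big),\\ v_1^{10}&=\Big(a_1a_2a_3+\tfrac{a_3(b_2-a_2)(b_1b_2b_3-a_1a_2a_3)}{D},\; a_1+\tfrac{a_3(b_2-a_2)(b_1-a_1)}{D},\; b_2,\; a_3\Big),\\ v_1^{11}&=\Big(\tfrac{b_2a_3(a_1b_2b_3-a_1a_2b_3-b_1a_2a_3+b_1a_2b_3)}{D},\;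 a_1+\tfrac{b_2(b_1-a_1)(b_3-a_3)}{D},\; b_2,\; a_3\Big),\\ v_1^{12}&=\Big(\tfrac{a_2b_3(b_1b_2a_3-b_1a_2a_3-a_1b_2a_3+a_1b_2b_3)}{D},\; a_1+\tfrac{b_3(b_2-a_2)(b_1-a_1)}{D},\; a_2,\; b_3\Big). \end{aligned}$$ Then the set of extreme points of $P_1$ is $\{v^1,\dots,v^8\}\cup\{v_1^9,v_1^{10},v_1^{11},v_1^{12}\}$. Moreover, the $4$-dimensional volumes of $P_1$ and $P_H$ are finite and $$\mathrm{Vol}(P_1)=\mathrm{Vol}(P_H)+(b_1-a_1)(b_2-a_2)^2(b_3-a_3)^2\;\frac{3(b_1b_2a_3-a_1b_2a_3+b_1a_2b_3-a_1a_2b_3)+2(a_1b_2b_3-b_1a_2a_3)}{24(b_2b_3-a_2a_3)} .$$ -/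

import Mathlib

/-- The system of linear inequalities of the double-McCormick convexification of `f = xᵢ xⱼ xₖ` over
`xᵢ ∈ [aᵢ, bᵢ]`, `xⱼ ∈ [aⱼ, bⱼ]`, `xₖ ∈ [aₖ, bₖ]` in which the pair `xᵢ, xⱼ` is grouped first: the result
of the Fourier-Motzkin elimination of `w` from the four McCormick inequalities of `w = xᵢ xⱼ` and the four
McCormick inequalities of `f = w xₖ` with `w ∈ [aᵢ aⱼ, bᵢ bⱼ]`. -/
def DoubleMcCormickSystem (ai bi aj bj ak bk f xi xj xk : ℝ) : Prop :=
  0 ≤ xi - ai ∧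
  0 ≤ xj - aj ∧
  0 ≤ f - aj * ak * xi - ai * ak * xj - ai * aj * xk + 2 * ai * aj * ak ∧
  0 ≤ f - aj * bk * xi - ai * bk * xj - bi * bj * xk + ai * aj * bk + bi * bj * bk ∧
  0 ≤ -xj + bj ∧
  0 ≤ -xi + bi ∧
  0 ≤ f - bj * ak * xi - bi * ak * xj - ai * aj * xk + ai * aj * ak + bi * bj * ak ∧
  0 ≤ f - bj * bk * xi - bi * bk * xj - bi * bj * xk + 2 * bi * bj * bk ∧
  0 ≤ -f + bj * bk * xi + ai * bk * xj + ai * aj * xk - ai * aj * bk - ai * bj * bk ∧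
  0 ≤ -f + aj * bk * xi + bi * bk * xj + ai * aj * xk - ai * aj * bk - bi * aj * bk ∧
  0 ≤ -xk + bk ∧
  0 ≤ -f + bj * ak * xi + ai * ak * xj + bi * bj * xk - ai * bj * ak - bi * bj * ak ∧
  0 ≤ -f + aj * ak * xi + bi * ak * xj + bi * bj * xk - bi * aj * ak - bi * bj * ak ∧
  0 ≤ xk - ak ∧
  0 ≤ f - ai * aj * xk ∧
  0 ≤ -f + bi * bj * xk

/-- The polytope `P₁ ⊆ ℝ⁴`, in coordinates `(f, x₁, x₂, x₃)`: the solution set of the double-McCormick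
system of `f = x₁ x₂ x₃` that groups `x₂` and `x₃` first. -/
def polytopeP1 (a₁ b₁ a₂ b₂ a₃ b₃ : ℝ) : Set (Fin 4 → ℝ) :=
  {p | DoubleMcCormickSystem a₂ b₂ a₃ b₃ a₁ b₁ (p 0) (p 2) (p 3) (p 1)}

/-- The system `H` of linear inequalities for the convex hull of the graph of `f = x₁ x₂ x₃` on the box. -/
def HullSystem (a₁ b₁ a₂ b₂ a₃ b₃ f x₁ x₂ x₃ : ℝ) : Prop :=
  let η₁ := b₁ * b₂ * a₃ - a₁ * b₂ * b₃ - b₁ * a₂ * a₃ + b₁ * a₂ * b₃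
  let η₂ := a₁ * a₂ * b₃ - b₁ * a₂ * a₃ - a₁ * b₂ * b₃ + a₁ * b₂ * a₃
  0 ≤ f - a₂ * a₃ * x₁ - a₁ * a₃ * x₂ - a₁ * a₂ * x₃ + 2 * a₁ * a₂ * a₃ ∧
  0 ≤ f - b₂ * b₃ * x₁ - b₁ * b₃ * x₂ - b₁ * b₂ * x₃ + 2 * b₁ * b₂ * b₃ ∧
  0 ≤ f - a₂ * b₃ * x₁ - a₁ * b₃ * x₂ - b₁ * a₂ * x₃ + a₁ * a₂ * b₃ + b₁ * a₂ * b₃ ∧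
  0 ≤ f - b₂ * a₃ * x₁ - b₁ * a₃ * x₂ - a₁ * b₂ * x₃ + b₁ * b₂ * a₃ + a₁ * b₂ * a₃ ∧
  0 ≤ f - η₁ / (b₁ - a₁) * x₁ - b₁ * a₃ * x₂ - b₁ * a₂ * x₃ +
    (η₁ * a₁ / (b₁ - a₁) + b₁ * b₂ * a₃ + b₁ * a₂ * b₃ - a₁ * b₂ * b₃) ∧
  0 ≤ f - η₂ / (a₁ - b₁) * x₁ - a₁ * b₃ * x₂ - a₁ * b₂ * x₃ +
    (η₂ * b₁ / (a₁ - b₁) + a₁ * a₂ * b₃ + a₁ * b₂ * a₃ - b₁ * a₂ * a₃) ∧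
  0 ≤ -f + a₂ * a₃ * x₁ + b₁ * a₃ * x₂ + b₁ * b₂ * x₃ - b₁ * b₂ * a₃ - b₁ * a₂ * a₃ ∧
  0 ≤ -f + b₂ * a₃ * x₁ + a₁ * a₃ * x₂ + b₁ * b₂ * x₃ - b₁ * b₂ * a₃ - a₁ * b₂ * a₃ ∧
  0 ≤ -f + a₂ * a₃ * x₁ + b₁ * b₃ * x₂ + b₁ * a₂ * x₃ - b₁ * a₂ * b₃ - b₁ * a₂ * a₃ ∧
  0 ≤ -f + b₂ * b₃ * x₁ + a₁ * a₃ * x₂ + a₁ * b₂ * x₃ - a₁ * b₂ * b₃ - a₁ * b₂ * a₃ ∧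
  0 ≤ -f + a₂ * b₃ * x₁ + b₁ * b₃ * x₂ + a₁ * a₂ * x₃ - b₁ * a₂ * b₃ - a₁ * a₂ * b₃ ∧
  0 ≤ -f + b₂ * b₃ * x₁ + a₁ * b₃ * x₂ + a₁ * a₂ * x₃ - a₁ * b₂ * b₃ - a₁ * a₂ * b₃ ∧
  0 ≤ x₁ - a₁ ∧ 0 ≤ -x₁ + b₁ ∧
  0 ≤ x₂ - a₂ ∧ 0 ≤ -x₂ + b₂ ∧
  0 ≤ x₃ - a₃ ∧ 0 ≤ -x₃ + b₃

/-- The polytope `P_H ⊆ ℝ⁴`, in coordinates `(f, x₁, x₂, x₃)`: the solution set of system `H`. -/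
def polytopeH (a₁ b₁ a₂ b₂ a₃ b₃ : ℝ) : Set (Fin 4 → ℝ) :=
  {p | HullSystem a₁ b₁ a₂ b₂ a₃ b₃ (p 0) (p 1) (p 2) (p 3)}

/-- The eight points `v¹, …, v⁸`, of the form `(x₁ x₂ x₃, x₁, x₂, x₃)` at the vertices of the box. -/
def boxPoints (a₁ b₁ a₂ b₂ a₃ b₃ : ℝ) : Set (Fin 4 → ℝ) :=
  { ![b₁ * a₂ * a₃, b₁, a₂, a₃],
    ![a₁ * a₂ * a₃, a₁, a₂, a₃],
    ![a₁ * a₂ * b₃, a₁, a₂, b₃],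
    ![a₁ * b₂ * a₃, a₁, b₂, a₃],
    ![a₁ * b₂ * b₃, a₁, b₂, b₃],
    ![b₁ * b₂ * b₃, b₁, b₂, b₃],
    ![b₁ * b₂ * a₃, b₁, b₂, a₃],
    ![b₁ * a₂ * b₃, b₁, a₂, b₃] }

/-- The four additional points `v₁⁹, v₁¹⁰, v₁¹¹, v₁¹²`. -/
noncomputable def extraPoints1 (a₁ b₁ a₂ b₂ a₃ b₃ : ℝ) : Set (Fin 4 → ℝ) :=
  let D := b₂ * b₃ - a₂ * a₃
  let θ₁ := a₁ * a₂ * a₃ + a₂ * (b₃ - a₃) * (b₁ * b₂ * b₃ - a₁ * a₂ * a₃) / D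
  let θ₂ := a₁ + a₂ * (b₁ - a₁) * (b₃ - a₃) / D
  let θ₃ := a₁ * a₂ * a₃ + a₃ * (b₂ - a₂) * (b₁ * b₂ * b₃ - a₁ * a₂ * a₃) / D
  let θ₄ := a₁ + a₃ * (b₂ - a₂) * (b₁ - a₁) / D
  let θ₅ := b₂ * a₃ * (a₁ * b₂ * b₃ - a₁ * a₂ * b₃ - b₁ * a₂ * a₃ + b₁ * a₂ * b₃) / D
  let θ₆ := a₁ + b₂ * (b₁ - a₁) * (b₃ - a₃) / D
  let θ₇ := a₂ * b₃ * (b₁ * b₂ * a₃ - b₁ * a₂ * a₃ - a₁ * b₂ * a₃ + a₁ * b₂ * b₃) / D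
  let θ₈ := a₁ + b₃ * (b₂ - a₂) * (b₁ - a₁) / D
  { ![θ₁, θ₂, a₂, b₃], ![θ₃, θ₄, b₂, a₃], ![θ₅, θ₆, b₂, a₃], ![θ₇, θ₈, a₂, b₃] }

open MeasureTheory Set

/-! Write `bᵢ = aᵢ + dᵢ` and `xᵢ = aᵢ + dᵢ tᵢ`. The box becomes the unit cube, and each polytope
becomes the region between the graphs of two piecewise linear functions `L ≤ U`. Its volume is `d₁
d₂ d₃ ∫ (U - L)`.

For `P₁`, the McCormick bounds of `f = w x₁` increase with `w` because `a₁ ≥ 0`. Eliminating `w`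
therefore puts the lower envelope of `x₂ x₃` into the lower bounds and the upper envelope into the
upper ones. Let `l` and `u` be these envelopes minus `a₂ a₃`, and let `W = b₂ b₃ - a₂ a₃`. Up to a
common affine term, `U = a₁ u + d₁ min(u, W t₁)` and `L = a₁ l + d₁ max(0, l - W (1 - t₁))`
(`boxPt_mem_polytopeP1_iff`). For `P_H`, `U` is built from minima of the `tᵢ`, and `L` from four
hinge functions whose coefficients are nonnegative by the assumed ordering, which says `a₁/d₁ ≤
a₂/d₂ ≤ a₃/d₃` (`boxPt_mem_polytopeH_iff`).

Extreme points: over a fixed `(t₂, t₃)`, `U` and `L` each have one break in `t₁`. The break and both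
ends vary affinely over each triangle of the square, cut along one diagonal for `U` and along the
other for `L`. So `P₁` is the hull of the points over the corners of the square
(`polytopeP1_subset_of_convex`). These are the eight box points and the breaks over the edges
`(0,1)` and `(1,0)`, and each is checked to be extreme.

Volumes: integrating first in `t₁` turns the `P₁` terms into quadratics in `u` and `l`. Everything
else is a linear combination of elementary integrals of `min` and `max`. -/

/-! ### Volume of a region between two graphs over a box. -/

/-- The integral over the unit cube, the first variable being integrated first. -/
noncomputable def cubeIntegral (F : ℝ → ℝ → ℝ → ℝ) : ℝ :=
  ∫ y in (0 : ℝ)..1, ∫ z in (0 : ℝ)..1, ∫ x in (0 : ℝ)..1, F x y z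

theorem setIntegral_cube_eq_cubeIntegral (F : ℝ → ℝ → ℝ → ℝ)
    (hF : Continuous fun q : ℝ × ℝ × ℝ => F q.1 q.2.1 q.2.2) :
    ∫ q in Icc (0 : ℝ) 1 ×ˢ (Icc (0 : ℝ) 1 ×ˢ Icc (0 : ℝ) 1), F q.1 q.2.1 q.2.2 =
      cubeIntegral F := by
  have hK : IsCompact (Icc (0 : ℝ) 1 ×ˢ (Icc (0 : ℝ) 1 ×ˢ Icc (0 : ℝ) 1)) :=
    isCompact_Icc.prod (isCompact_Icc.prod isCompact_Icc)
  have hI := hF.continuousOn.integrableOn_compact (μ := volume) hK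
  have hG : Continuous fun y : ℝ × ℝ => ∫ x in (0 : ℝ)..1, F x y.1 y.2 := by
    apply intervalIntegral.continuous_parametric_intervalIntegral_of_continuous'
      (f := fun (y : ℝ × ℝ) x => F x y.1 y.2)
    exact hF.comp (by fun_prop : Continuous fun p : (ℝ × ℝ) × ℝ => (p.2, p.1))
  have hJ := hG.continuousOn.integrableOn_compact (μ := volume)
    ((isCompact_Icc (a := (0 : ℝ)) (b := 1)).prod (isCompact_Icc (a := (0 : ℝ)) (b := 1)))
  have e : ∀ f : ℝ → ℝ, ∫ x in Icc (0 : ℝ) 1, f x = ∫ x in (0 : ℝ)..1, f x := fun f => by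
    rw [intervalIntegral.integral_of_le zero_le_one, integral_Icc_eq_integral_Ioc]
  unfold IntegrableOn at hI hJ
  rw [Measure.volume_eq_prod, ← Measure.prod_restrict] at hI ⊢
  rw [integral_prod_symm _ hI]
  simp only [e]
  rw [Measure.volume_eq_prod, ← Measure.prod_restrict] at hJ ⊢
  rw [integral_prod _ hJ]
  simp only [e]
  rfl

/-- Fubini with `f` as the inner variable: the fibre over a point of the cube is an interval of
length `U - L`. -/
theorem volume_between_unit_cube (L U : ℝ → ℝ → ℝ → ℝ)
    (hL : Continuous fun q : ℝ × ℝ × ℝ => L q.1 q.2.1 q.2.2)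
    (hU : Continuous fun q : ℝ × ℝ × ℝ => U q.1 q.2.1 q.2.2)
    (hLU : ∀ x ∈ Icc (0 : ℝ) 1, ∀ y ∈ Icc (0 : ℝ) 1, ∀ z ∈ Icc (0 : ℝ) 1, L x y z ≤ U x y z) :
    volume {p : Fin 4 → ℝ | p 1 ∈ Icc (0 : ℝ) 1 ∧ p 2 ∈ Icc (0 : ℝ) 1 ∧ p 3 ∈ Icc (0 : ℝ) 1 ∧
      p 0 ∈ Icc (L (p 1) (p 2) (p 3)) (U (p 1) (p 2) (p 3))} =
    ENNReal.ofReal (cubeIntegral fun x y z => U x y z - L x y z) := by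
  set Q : Set (ℝ × ℝ × ℝ) := Icc (0 : ℝ) 1 ×ˢ (Icc (0 : ℝ) 1 ×ˢ Icc (0 : ℝ) 1) with hQ
  have hQm : MeasurableSet Q := measurableSet_Icc.prod (measurableSet_Icc.prod measurableSet_Icc)
  set S : Set (ℝ × ℝ × ℝ × ℝ) :=
    {r | r.2 ∈ Q ∧ r.1 ∈ Icc (L r.2.1 r.2.2.1 r.2.2.2) (U r.2.1 r.2.2.1 r.2.2.2)} with hS
  have hSm : MeasurableSet S := by
    refine (measurable_snd hQm).inter ?_
    refine (measurableSet_le ?_ measurable_fst).inter (measurableSet_le measurable_fst ?_)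
    · exact hL.measurable.comp measurable_snd
    · exact hU.measurable.comp measurable_snd
  have h2 := volume_preserving_finTwoArrow ℝ
  have h3 := ((MeasurePreserving.id volume).prod h2).comp
    (volume_preserving_piFinSuccAbove (fun _ : Fin 3 => ℝ) 0)
  have h4 := ((MeasurePreserving.id volume).prod h3).comp
    (volume_preserving_piFinSuccAbove (fun _ : Fin 4 => ℝ) 0)
  have h5 := h4.measure_preimage hSm.nullMeasurableSet
  have h6 : volume S = ENNReal.ofReal (cubeIntegral fun x y z => U x y z - L x y z) := by
    rw [← setIntegral_cube_eq_cubeIntegral (fun x y z => U x y z - L x y z) (hU.sub hL)]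
    rw [Measure.volume_eq_prod, Measure.prod_apply_symm hSm, ofReal_integral_eq_lintegral_ofReal]
    · rw [← lintegral_indicator hQm]
      congr 1
      ext q
      by_cases hq : q ∈ Q
      · rw [indicator_of_mem hq, ← Real.volume_Icc]
        congr 1
        ext f
        simp [hS, hq]
      · rw [indicator_of_notMem hq]
        convert measure_empty (μ := (volume : Measure ℝ))
        ext f
        simp [hS, hq]
    · exact (hU.sub hL).continuousOn.integrableOn_compact
        (isCompact_Icc.prod (isCompact_Icc.prod isCompact_Icc))
    · filter_upwards [ae_restrict_mem hQm] with q hq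
      exact sub_nonneg.2 (hLU _ hq.1 _ hq.2.1 _ hq.2.2)
  refine Eq.trans ?_ (h5.trans h6)
  congr 1
  ext p
  simp only [hS, hQ, mem_ofPred_eq, mem_preimage, mem_prod]
  constructor
  · rintro ⟨h1, h2, h3, h⟩
    exact ⟨⟨h1, h2, h3⟩, h⟩
  · rintro ⟨⟨h1, h2, h3⟩, h⟩
    exact ⟨h1, h2, h3, h⟩

/-- The box is the image of the cube under a translation and a diagonal map of determinant `d₁ d₂
d₃`; the `f`-axis is left unscaled. -/
theorem volume_between_box {a₁ a₂ a₃ d₁ d₂ d₃ : ℝ} (hd₁ : 0 < d₁) (hd₂ : 0 < d₂) (hd₃ : 0 < d₃)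
    {P : Set (Fin 4 → ℝ)} (L U : ℝ → ℝ → ℝ → ℝ)
    (hL : Continuous fun q : ℝ × ℝ × ℝ => L q.1 q.2.1 q.2.2)
    (hU : Continuous fun q : ℝ × ℝ × ℝ => U q.1 q.2.1 q.2.2)
    (hLU : ∀ x ∈ Icc (0 : ℝ) 1, ∀ y ∈ Icc (0 : ℝ) 1, ∀ z ∈ Icc (0 : ℝ) 1, L x y z ≤ U x y z)
    (hP : ∀ f x y z, ![f, a₁ + d₁ * x, a₂ + d₂ * y, a₃ + d₃ * z] ∈ P ↔
      x ∈ Icc (0 : ℝ) 1 ∧ y ∈ Icc (0 : ℝ) 1 ∧ z ∈ Icc (0 : ℝ) 1 ∧ f ∈ Icc (L x y z) (U x y z)) :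
    volume P = ENNReal.ofReal (d₁ * d₂ * d₃ * cubeIntegral fun x y z => U x y z - L x y z) := by
  set A : (Fin 4 → ℝ) →ₗ[ℝ] (Fin 4 → ℝ) := Matrix.toLin' (Matrix.diagonal ![1, d₁, d₂, d₃]) with hA
  have hdet : LinearMap.det A = d₁ * d₂ * d₃ := by
    rw [hA, LinearMap.det_toLin', Matrix.det_diagonal]
    simp [Fin.prod_univ_four]
  have h := Measure.addHaar_preimage_linearMap volume (f := A) (by rw [hdet]; positivity)
    ((fun p => ![0, a₁, a₂, a₃] + p) ⁻¹' P)
  rw [measure_preimage_add, hdet] at h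
  have hS := volume_between_unit_cube L U hL hU hLU
  have hE : A ⁻¹' ((fun p => ![0, a₁, a₂, a₃] + p) ⁻¹' P) =
      {p : Fin 4 → ℝ | p 1 ∈ Icc (0 : ℝ) 1 ∧ p 2 ∈ Icc (0 : ℝ) 1 ∧ p 3 ∈ Icc (0 : ℝ) 1 ∧
      p 0 ∈ Icc (L (p 1) (p 2) (p 3)) (U (p 1) (p 2) (p 3))} := by
    ext p
    rw [mem_ofPred_eq, ← hP, mem_preimage, mem_preimage]
    have : ![0, a₁, a₂, a₃] + A p =
        ![p 0, a₁ + d₁ * p 1, a₂ + d₂ * p 2, a₃ + d₃ * p 3] := by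
      ext i
      fin_cases i <;> simp [hA, Matrix.mulVec_diagonal]
    rw [this]
  rw [hE, hS] at h
  have hpos : 0 < d₁ * d₂ * d₃ := by positivity
  rw [ENNReal.ofReal_mul hpos.le, h, ← mul_assoc, ← ENNReal.ofReal_mul hpos.le, abs_of_pos (inv_pos.2 hpos),
    mul_inv_cancel₀ hpos.ne', ENNReal.ofReal_one, one_mul]

/-! ### Integrals of piecewise polynomials on the unit interval. -/

theorem integral_quartic (c₀ c₁ c₂ c₃ c₄ a b : ℝ) :
    ∫ t in a..b, (c₀ + c₁ * t + c₂ * t ^ 2 + c₃ * t ^ 3 + c₄ * t ^ 4) =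
      c₀ * (b - a) + c₁ * (b ^ 2 - a ^ 2) / 2 + c₂ * (b ^ 3 - a ^ 3) / 3 +
        c₃ * (b ^ 4 - a ^ 4) / 4 + c₄ * (b ^ 5 - a ^ 5) / 5 := by
  rw [intervalIntegral.integral_eq_sub_of_hasDerivAt (f := fun t => c₀ * t + c₁ * (t ^ 2 / 2) +
    c₂ * (t ^ 3 / 3) + c₃ * (t ^ 4 / 4) + c₄ * (t ^ 5 / 5))]
  · ring
  · intro t _
    have h (n : ℕ) := hasDerivAt_pow n t
    have := (((((hasDerivAt_id' t).const_mul c₀).add (((h 2).div_const 2).const_mul c₁)).add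
      (((h 3).div_const 3).const_mul c₂)).add (((h 4).div_const 4).const_mul c₃)).add
      (((h 5).div_const 5).const_mul c₄)
    refine this.congr_deriv ?_
    norm_num
  · exact Continuous.intervalIntegrable (by fun_prop) _ _

theorem integral_unit_of_eq_quartic {F : ℝ → ℝ} (c₀ c₁ c₂ c₃ c₄ : ℝ)
    (h : ∀ t ∈ Icc (0 : ℝ) 1, F t = c₀ + c₁ * t + c₂ * t ^ 2 + c₃ * t ^ 3 + c₄ * t ^ 4) :
    ∫ t in (0 : ℝ)..1, F t = c₀ + c₁ / 2 + c₂ / 3 + c₃ / 4 + c₄ / 5 := by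
  have := integral_quartic c₀ c₁ c₂ c₃ c₄ 0 1
  rw [intervalIntegral.integral_congr (g := fun t => c₀ + c₁ * t + c₂ * t ^ 2 + c₃ * t ^ 3 + c₄ * t ^ 4),
    this]
  · ring
  · intro t ht
    rw [uIcc_of_le zero_le_one] at ht
    exact h t ht

theorem integral_unit_of_eq_quadratics {F : ℝ → ℝ} {c : ℝ} (hc : c ∈ Icc (0 : ℝ) 1)
    (p₀ p₁ p₂ q₀ q₁ q₂ : ℝ)
    (hp : ∀ t ∈ Icc (0 : ℝ) 1, t ≤ c → F t = p₀ + p₁ * t + p₂ * t ^ 2)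
    (hq : ∀ t ∈ Icc (0 : ℝ) 1, c ≤ t → F t = q₀ + q₁ * t + q₂ * t ^ 2) :
    ∫ t in (0 : ℝ)..1, F t = p₀ * c + p₁ * c ^ 2 / 2 + p₂ * c ^ 3 / 3 +
      (q₀ * (1 - c) + q₁ * (1 - c ^ 2) / 2 + q₂ * (1 - c ^ 3) / 3) := by
  have e1 : EqOn F (fun t => p₀ + p₁ * t + p₂ * t ^ 2 + 0 * t ^ 3 + 0 * t ^ 4) (uIcc 0 c) := by
    intro t ht
    rw [uIcc_of_le hc.1] at ht
    simp [hp t ⟨ht.1, ht.2.trans hc.2⟩ ht.2]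
  have e2 : EqOn F (fun t => q₀ + q₁ * t + q₂ * t ^ 2 + 0 * t ^ 3 + 0 * t ^ 4) (uIcc c 1) := by
    intro t ht
    rw [uIcc_of_le hc.2] at ht
    simp [hq t ⟨hc.1.trans ht.1, ht.2⟩ ht.1]
  have i1 : IntervalIntegrable F volume 0 c :=
    (Continuous.continuousOn (by fun_prop) |>.congr e1).intervalIntegrable
  have i2 : IntervalIntegrable F volume c 1 :=
    (Continuous.continuousOn (by fun_prop) |>.congr e2).intervalIntegrable
  rw [← intervalIntegral.integral_add_adjacent_intervals i1 i2, intervalIntegral.integral_congr e1,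
    intervalIntegral.integral_congr e2, integral_quartic, integral_quartic]
  ring

theorem integral_unit_congr {F G : ℝ → ℝ} (h : ∀ t ∈ Icc (0 : ℝ) 1, F t = G t) :
    ∫ t in (0 : ℝ)..1, F t = ∫ t in (0 : ℝ)..1, G t := by
  apply intervalIntegral.integral_congr
  intro t ht
  rw [uIcc_of_le zero_le_one] at ht
  exact h t ht

theorem cubeIntegral_of_inner {F : ℝ → ℝ → ℝ → ℝ} {G : ℝ → ℝ → ℝ} {H : ℝ → ℝ} {c : ℝ}
    (hG : ∀ y ∈ Icc (0 : ℝ) 1, ∀ z ∈ Icc (0 : ℝ) 1, ∫ x in (0 : ℝ)..1, F x y z = G y z)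
    (hH : ∀ y ∈ Icc (0 : ℝ) 1, ∫ z in (0 : ℝ)..1, G y z = H y)
    (hc : ∫ y in (0 : ℝ)..1, H y = c) : cubeIntegral F = c := by
  rw [← hc]
  exact integral_unit_congr fun y hy => (integral_unit_congr (hG y hy)).trans (hH y hy)

theorem cubeIntegral_congr {F G : ℝ → ℝ → ℝ → ℝ} (h : ∀ x ∈ Icc (0 : ℝ) 1, ∀ y ∈ Icc (0 : ℝ) 1,
    ∀ z ∈ Icc (0 : ℝ) 1, F x y z = G x y z) : cubeIntegral F = cubeIntegral G :=
  integral_unit_congr fun y hy => integral_unit_congr fun z hz => integral_unit_congr fun x hx =>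
    h x hx y hy z hz

/-- Linearity is proved once on the product measure, where integrability follows from compactness,
so that no iterated integral has to be split level by level. -/
theorem cubeIntegral_linear (n : ℕ) (c : Fin n → ℝ) (F : Fin n → ℝ → ℝ → ℝ → ℝ)
    (hF : ∀ i, Continuous fun q : ℝ × ℝ × ℝ => F i q.1 q.2.1 q.2.2) :
    cubeIntegral (fun x y z => ∑ i, c i * F i x y z) = ∑ i, c i * cubeIntegral (F i) := by
  have hs : Continuous fun q : ℝ × ℝ × ℝ => ∑ i, c i * F i q.1 q.2.1 q.2.2 :=
    continuous_finsetSum _ fun i _ => continuous_const.mul (hF i)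
  have hK : IsCompact (Icc (0 : ℝ) 1 ×ˢ (Icc (0 : ℝ) 1 ×ˢ Icc (0 : ℝ) 1)) :=
    isCompact_Icc.prod (isCompact_Icc.prod isCompact_Icc)
  rw [← setIntegral_cube_eq_cubeIntegral _ hs, integral_finsetSum]
  · refine Finset.sum_congr rfl fun i _ => ?_
    rw [integral_const_mul, setIntegral_cube_eq_cubeIntegral _ (hF i)]
  · intro i _
    exact (continuous_const.mul (hF i)).continuousOn.integrableOn_compact hK

/-- The assumption `c ≤ W` places the kink `c / W` inside the unit interval. -/
theorem integral_min_mul {W c : ℝ} (hW : 0 < W) (h0 : 0 ≤ c) (h1 : c ≤ W) :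
    ∫ x in (0 : ℝ)..1, min c (W * x) = c - c ^ 2 / (2 * W) := by
  have hc : c / W ∈ Icc (0 : ℝ) 1 := ⟨by positivity, by rwa [div_le_one hW]⟩
  rw [integral_unit_of_eq_quadratics hc 0 W 0 c 0 0]
  · field_simp; ring
  · intro x _ hx
    rw [le_div_iff₀' hW] at hx
    rw [min_eq_right hx]; ring
  · intro x _ hx
    rw [div_le_iff₀' hW] at hx
    rw [min_eq_left hx]; ring

theorem integral_max_sub_mul {W c : ℝ} (hW : 0 < W) (h0 : 0 ≤ c) (h1 : c ≤ W) :
    ∫ x in (0 : ℝ)..1, max 0 (c - W * (1 - x)) = c ^ 2 / (2 * W) := by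
  have hc : 1 - c / W ∈ Icc (0 : ℝ) 1 := by
    have : c / W ≤ 1 := by rwa [div_le_one hW]
    have : 0 ≤ c / W := by positivity
    constructor <;> linarith
  have e : W * (1 - c / W) = W - c := by field_simp
  rw [integral_unit_of_eq_quadratics hc 0 0 0 (c - W) W 0]
  · field_simp; ring
  · intro x _ hx
    have := mul_le_mul_of_nonneg_left hx hW.le
    rw [max_eq_left (by linarith)]; ring
  · intro x _ hx
    have := mul_le_mul_of_nonneg_left hx hW.le
    rw [max_eq_right (by linarith)]; ring

/-- The integrand has the shape left after integrating a McCormick bound in `x`: a quadratic in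
`pairUpper`, with its kink at `z = y`. The choice `r = s = 0` gives the moments of `min y z`. -/
theorem integral_min_quadratic {y : ℝ} (hy : y ∈ Icc (0 : ℝ) 1) (r s k m n : ℝ) :
    ∫ z in (0 : ℝ)..1, (m * (r * y + s * z + k * min y z) + n * (r * y + s * z + k * min y z) ^ 2) =
      m * (r * y + s / 2 + k * (y - y ^ 2 / 2)) +
      n * (r ^ 2 * y ^ 2 + s ^ 2 / 3 + r * s * y + k ^ 2 * (y ^ 2 - 2 * y ^ 3 / 3) +
        2 * k * r * y * (y - y ^ 2 / 2) + 2 * k * s * (y / 2 - y ^ 3 / 6)) := by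
  rw [integral_unit_of_eq_quadratics hy (m * (r * y) + n * (r * y) ^ 2)
    (m * (s + k) + 2 * n * (r * y) * (s + k)) (n * (s + k) ^ 2)
    (m * ((r + k) * y) + n * ((r + k) * y) ^ 2) (m * s + 2 * n * ((r + k) * y) * s) (n * s ^ 2)]
  · ring
  · intro z _ hz
    rw [min_eq_right hz]; ring
  · intro z _ hz
    rw [min_eq_left hz]; ring

theorem integral_max_quadratic {y : ℝ} (hy : y ∈ Icc (0 : ℝ) 1) (r s k m n : ℝ) :
    ∫ z in (0 : ℝ)..1, (m * (r * y + s * z + k * max 0 (y + z - 1)) +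
        n * (r * y + s * z + k * max 0 (y + z - 1)) ^ 2) =
      m * (r * y + s / 2 + k * (y ^ 2 / 2)) +
      n * (r ^ 2 * y ^ 2 + s ^ 2 / 3 + r * s * y + k ^ 2 * (y ^ 3 / 3) +
        2 * k * r * y * (y ^ 2 / 2) + 2 * k * s * (y ^ 2 / 2 - y ^ 3 / 6)) := by
  have hc : 1 - y ∈ Icc (0 : ℝ) 1 := ⟨by linarith [hy.2], by linarith [hy.1]⟩
  rw [integral_unit_of_eq_quadratics hc (m * (r * y) + n * (r * y) ^ 2)
    (m * s + 2 * n * (r * y) * s) (n * s ^ 2)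
    (m * (r * y + k * (y - 1)) + n * (r * y + k * (y - 1)) ^ 2)
    (m * (s + k) + 2 * n * (r * y + k * (y - 1)) * (s + k)) (n * (s + k) ^ 2)]
  · ring
  · intro z _ hz
    rw [max_eq_left (by linarith)]; ring
  · intro z _ hz
    rw [max_eq_right (by linarith)]; ring

/-! ### Elementary `min` and `max` integrals over the cube. -/

theorem cubeIntegral_min_yz : cubeIntegral (fun _ y z => min y z) = 1 / 3 := by
  refine cubeIntegral_of_inner (G := fun y z => min y z) (H := fun y => y - y ^ 2 / 2) ?_ ?_ ?_
  · intro y _ z _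
    simp
  · intro y hy
    have := integral_min_quadratic hy 0 0 1 1 0
    simpa using this
  · rw [integral_unit_of_eq_quartic 0 1 (-1 / 2) 0 0 (fun t _ => by ring)]; norm_num

theorem cubeIntegral_min_xy : cubeIntegral (fun x y _ => min x y) = 1 / 3 := by
  refine cubeIntegral_of_inner (G := fun y _ => y - y ^ 2 / 2) (H := fun y => y - y ^ 2 / 2) ?_ ?_ ?_
  · intro y hy z _
    have := integral_min_quadratic hy 0 0 1 1 0
    simpa [min_comm] using this
  · intro y hy
    simp
  · rw [integral_unit_of_eq_quartic 0 1 (-1 / 2) 0 0 (fun t _ => by ring)]; norm_num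

theorem cubeIntegral_min_xz : cubeIntegral (fun x _ z => min x z) = 1 / 3 := by
  refine cubeIntegral_of_inner (G := fun _ z => z - z ^ 2 / 2) (H := fun _ => 1 / 3) ?_ ?_ ?_
  · intro y _ z hz
    have := integral_min_quadratic hz 0 0 1 1 0
    simpa [min_comm] using this
  · intro y hy
    rw [integral_unit_of_eq_quartic 0 1 (-1 / 2) 0 0 (fun t _ => by ring)]; norm_num
  · simp

theorem cubeIntegral_min_xyz : cubeIntegral (fun x y z => min x (min y z)) = 1 / 4 := by
  refine cubeIntegral_of_inner (G := fun y z => min y z - min y z ^ 2 / 2)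
    (H := fun y => y - y ^ 2 / 2 - (y ^ 2 - 2 * y ^ 3 / 3) / 2) ?_ ?_ ?_
  · intro y hy z hz
    have := integral_min_mul zero_lt_one (le_min hy.1 hz.1) ((min_le_left _ _).trans hy.2)
    simpa [min_comm] using this
  · intro y hy
    have := integral_min_quadratic hy 0 0 1 1 (-1 / 2)
    ring_nf at this ⊢
    exact this
  · rw [integral_unit_of_eq_quartic 0 1 (-1) (1 / 3) 0 (fun t _ => by ring)]; norm_num

theorem cubeIntegral_max_yz : cubeIntegral (fun _ y z => max 0 (y + z - 1)) = 1 / 6 := by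
  refine cubeIntegral_of_inner (G := fun y z => max 0 (y + z - 1)) (H := fun y => y ^ 2 / 2) ?_ ?_ ?_
  · intro y _ z _
    simp
  · intro y hy
    have := integral_max_quadratic hy 0 0 1 1 0
    simpa using this
  · rw [integral_unit_of_eq_quartic 0 0 (1 / 2) 0 0 (fun t _ => by ring)]; norm_num

theorem cubeIntegral_max_xy : cubeIntegral (fun x y _ => max 0 (x + y - 1)) = 1 / 6 := by
  refine cubeIntegral_of_inner (G := fun y _ => y ^ 2 / 2) (H := fun y => y ^ 2 / 2) ?_ ?_ ?_
  · intro y hy z _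
    have := integral_max_quadratic hy 0 0 1 1 0
    simpa [add_comm] using this
  · intro y hy
    simp
  · rw [integral_unit_of_eq_quartic 0 0 (1 / 2) 0 0 (fun t _ => by ring)]; norm_num

theorem cubeIntegral_max_xz : cubeIntegral (fun x _ z => max 0 (x + z - 1)) = 1 / 6 := by
  refine cubeIntegral_of_inner (G := fun _ z => z ^ 2 / 2) (H := fun _ => 1 / 6) ?_ ?_ ?_
  · intro y _ z hz
    have := integral_max_quadratic hz 0 0 1 1 0
    simpa [add_comm] using this
  · intro y hy
    rw [integral_unit_of_eq_quartic 0 0 (1 / 2) 0 0 (fun t _ => by ring)]; norm_num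
  · simp

theorem cubeIntegral_max_sub_two : cubeIntegral (fun x y z => max 0 (x + y + z - 2)) = 1 / 24 := by
  refine cubeIntegral_of_inner (G := fun y z => max 0 (y + z - 1) ^ 2 / 2)
    (H := fun y => y ^ 3 / 6) ?_ ?_ ?_
  · intro y hy z hz
    have h := integral_max_sub_mul zero_lt_one (le_max_left 0 (y + z - 1))
      (max_le zero_le_one (by linarith [hy.2, hz.2]))
    rw [mul_one] at h
    rw [← h]
    refine integral_unit_congr fun x hx => ?_
    have := hx.2
    rcases max_cases 0 (y + z - 1) with ⟨h, h'⟩ | ⟨h, h'⟩ <;> rw [h]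
    · rw [max_eq_left (by linarith), max_eq_left (by linarith)]
    · congr 1; ring
  · intro y hy
    have := integral_max_quadratic hy 0 0 1 0 (1 / 2)
    ring_nf at this ⊢
    exact this
  · rw [integral_unit_of_eq_quartic 0 0 0 (1 / 6) 0 (fun t _ => by ring)]; norm_num

theorem cubeIntegral_max_sub_one : cubeIntegral (fun x y z => max 0 (x + y + z - 1)) = 13 / 24 := by
  -- Without truncation the inner integral would be `y + z - 1/2`; the squared hinge is the
  -- correction where `x + y + z - 1` starts negative.
  refine cubeIntegral_of_inner (G := fun y z => y + z - 1 / 2 + max 0 (1 - y - z) ^ 2 / 2)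
    (H := fun y => y + (1 - y) ^ 3 / 6) ?_ ?_ ?_
  · intro y hy z hz
    rcases max_cases 0 (1 - y - z) with ⟨h, h'⟩ | ⟨h, h'⟩ <;> rw [h]
    · rw [integral_unit_of_eq_quartic (y + z - 1) 1 0 0 0]
      · ring
      · intro x hx
        rw [max_eq_right (by linarith [hx.1])]; ring
    · have hc : 1 - y - z ∈ Icc (0 : ℝ) 1 := ⟨by linarith, by linarith [hy.1, hz.1]⟩
      rw [integral_unit_of_eq_quadratics hc 0 0 0 (y + z - 1) 1 0]
      · ring
      · intro x _ hx
        rw [max_eq_left (by linarith)]; ring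
      · intro x _ hx
        rw [max_eq_right (by linarith)]; ring
  · intro y hy
    have hc : 1 - y ∈ Icc (0 : ℝ) 1 := ⟨by linarith [hy.2], by linarith [hy.1]⟩
    rw [integral_unit_of_eq_quadratics hc (y - 1 / 2 + (1 - y) ^ 2 / 2) (1 - (1 - y)) (1 / 2)
      (y - 1 / 2) 1 0]
    · ring
    · intro z _ hz
      rw [max_eq_right (by linarith)]; ring
    · intro z _ hz
      rw [max_eq_left (by linarith)]; ring
  · rw [integral_unit_of_eq_quartic (1 / 6) (1 / 2) (1 / 2) (-1 / 6) 0 (fun t _ => by ring)]; norm_num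

/-! ### The polytope `P₁` as a region between two graphs. -/

/-- The concave McCormick upper bound of `x₂ x₃ - a₂ a₃` at `xᵢ = aᵢ + dᵢ tᵢ`. -/
noncomputable def pairUpper (a₂ d₂ a₃ d₃ y z : ℝ) : ℝ := a₃ * d₂ * y + a₂ * d₃ * z + d₂ * d₃ * min y z

/-- The convex McCormick lower bound of `x₂ x₃ - a₂ a₃` at `xᵢ = aᵢ + dᵢ tᵢ`. -/
noncomputable def pairLower (a₂ d₂ a₃ d₃ y z : ℝ) : ℝ :=
  a₃ * d₂ * y + a₂ * d₃ * z + d₂ * d₃ * max 0 (y + z - 1)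

/-- The difference `b₂ b₃ - a₂ a₃` for `bᵢ = aᵢ + dᵢ`. -/
def pairWidth (a₂ d₂ a₃ d₃ : ℝ) : ℝ := (a₂ + d₂) * (a₃ + d₃) - a₂ * a₃

/-- The upper bound on `f` given by the double-McCormick system, at `xᵢ = aᵢ + dᵢ tᵢ`. -/
noncomputable def upperP1 (a₁ d₁ a₂ d₂ a₃ d₃ x y z : ℝ) : ℝ :=
  a₁ * (a₂ * a₃) + d₁ * (a₂ * a₃) * x + a₁ * pairUpper a₂ d₂ a₃ d₃ y z +
    d₁ * min (pairUpper a₂ d₂ a₃ d₃ y z) (pairWidth a₂ d₂ a₃ d₃ * x)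

/-- The lower bound on `f` given by the double-McCormick system, at `xᵢ = aᵢ + dᵢ tᵢ`. -/
noncomputable def lowerP1 (a₁ d₁ a₂ d₂ a₃ d₃ x y z : ℝ) : ℝ :=
  a₁ * (a₂ * a₃) + d₁ * (a₂ * a₃) * x + a₁ * pairLower a₂ d₂ a₃ d₃ y z +
    d₁ * max 0 (pairLower a₂ d₂ a₃ d₃ y z - pairWidth a₂ d₂ a₃ d₃ * (1 - x))

/-- The point of `ℝ⁴` with first coordinate `f` above the point of the box with relative coordinates
`x, y, z`. -/
def boxPt (a₁ d₁ a₂ d₂ a₃ d₃ f x y z : ℝ) : Fin 4 → ℝ :=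
  ![f, a₁ + d₁ * x, a₂ + d₂ * y, a₃ + d₃ * z]

section bounds

variable {a₁ d₁ a₂ d₂ a₃ d₃ : ℝ}

theorem exists_eq_boxPt (hd₁ : 0 < d₁) (hd₂ : 0 < d₂) (hd₃ : 0 < d₃) (p : Fin 4 → ℝ) :
    ∃ f x y z, p = boxPt a₁ d₁ a₂ d₂ a₃ d₃ f x y z := by
  refine ⟨p 0, (p 1 - a₁) / d₁, (p 2 - a₂) / d₂, (p 3 - a₃) / d₃, ?_⟩
  ext i
  fin_cases i <;> simp [boxPt] <;> field_simp <;> ring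

theorem pairWidth_pos (ha₂ : 0 ≤ a₂) (hd₂ : 0 < d₂) (ha₃ : 0 ≤ a₃) (hd₃ : 0 < d₃) :
    0 < pairWidth a₂ d₂ a₃ d₃ := by
  have : pairWidth a₂ d₂ a₃ d₃ = a₂ * d₃ + d₂ * a₃ + d₂ * d₃ := by unfold pairWidth; ring
  rw [this]; positivity

theorem pairUpper_nonneg (ha₂ : 0 ≤ a₂) (hd₂ : 0 < d₂) (ha₃ : 0 ≤ a₃) (hd₃ : 0 < d₃) {y z : ℝ}
    (hy : 0 ≤ y) (hz : 0 ≤ z) : 0 ≤ pairUpper a₂ d₂ a₃ d₃ y z := by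
  have := le_min hy hz
  unfold pairUpper; positivity

theorem pairLower_nonneg (ha₂ : 0 ≤ a₂) (hd₂ : 0 < d₂) (ha₃ : 0 ≤ a₃) (hd₃ : 0 < d₃) {y z : ℝ}
    (hy : 0 ≤ y) (hz : 0 ≤ z) : 0 ≤ pairLower a₂ d₂ a₃ d₃ y z := by
  have := le_max_left 0 (y + z - 1)
  unfold pairLower; positivity

theorem pairLower_le_pairUpper (hd₂ : 0 < d₂) (hd₃ : 0 < d₃) {y z : ℝ}
    (hy : y ∈ Icc (0 : ℝ) 1) (hz : z ∈ Icc (0 : ℝ) 1) :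
    pairLower a₂ d₂ a₃ d₃ y z ≤ pairUpper a₂ d₂ a₃ d₃ y z := by
  obtain ⟨hy0, hy1⟩ := hy
  obtain ⟨hz0, hz1⟩ := hz
  have : max 0 (y + z - 1) ≤ min y z :=
    max_le (le_min hy0 hz0) (le_min (by linarith) (by linarith))
  unfold pairLower pairUpper
  gcongr

theorem pairUpper_le_pairWidth (ha₂ : 0 ≤ a₂) (hd₂ : 0 < d₂) (ha₃ : 0 ≤ a₃) (hd₃ : 0 < d₃)
    {y z : ℝ} (hy : y ≤ 1) (hz : z ≤ 1) :
    pairUpper a₂ d₂ a₃ d₃ y z ≤ pairWidth a₂ d₂ a₃ d₃ := by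
  have h1 : min y z ≤ 1 := (min_le_left _ _).trans hy
  have h2 : a₃ * d₂ * y ≤ a₃ * d₂ * 1 := by gcongr
  have h3 : a₂ * d₃ * z ≤ a₂ * d₃ * 1 := by gcongr
  have h4 : d₂ * d₃ * min y z ≤ d₂ * d₃ * 1 := by gcongr
  unfold pairUpper pairWidth
  linarith

theorem lowerP1_le_upperP1 (ha₁ : 0 ≤ a₁) (hd₁ : 0 < d₁) (ha₂ : 0 ≤ a₂) (hd₂ : 0 < d₂)
    (ha₃ : 0 ≤ a₃) (hd₃ : 0 < d₃) {x y z : ℝ} (hx : x ∈ Icc (0 : ℝ) 1) (hy : y ∈ Icc (0 : ℝ) 1)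
    (hz : z ∈ Icc (0 : ℝ) 1) :
    lowerP1 a₁ d₁ a₂ d₂ a₃ d₃ x y z ≤ upperP1 a₁ d₁ a₂ d₂ a₃ d₃ x y z := by
  have h1 := pairLower_le_pairUpper (a₂ := a₂) (a₃ := a₃) hd₂ hd₃ hy hz
  have h2 := pairUpper_le_pairWidth ha₂ hd₂ ha₃ hd₃ hy.2 hz.2
  have h3 := pairUpper_nonneg ha₂ hd₂ ha₃ hd₃ hy.1 hz.1
  have hW := pairWidth_pos ha₂ hd₂ ha₃ hd₃
  have h4 : 0 ≤ pairWidth a₂ d₂ a₃ d₃ * x := mul_nonneg hW.le hx.1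
  have h5 : 0 ≤ pairWidth a₂ d₂ a₃ d₃ * (1 - x) := mul_nonneg hW.le (sub_nonneg.2 hx.2)
  have : max 0 (pairLower a₂ d₂ a₃ d₃ y z - pairWidth a₂ d₂ a₃ d₃ * (1 - x)) ≤
      min (pairUpper a₂ d₂ a₃ d₃ y z) (pairWidth a₂ d₂ a₃ d₃ * x) :=
    max_le (le_min h3 h4) (le_min (by linarith) (by linarith))
  unfold lowerP1 upperP1
  gcongr

/-- Two pieces of the envelope of `x₂ x₃` times two pieces of the outer McCormick bound give four
lower facets, and likewise four upper ones. -/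
theorem boxPt_mem_polytopeP1_iff (ha₁ : 0 ≤ a₁) (hd₁ : 0 < d₁) (ha₂ : 0 ≤ a₂) (hd₂ : 0 < d₂)
    (ha₃ : 0 ≤ a₃) (hd₃ : 0 < d₃) (f x y z : ℝ) :
    boxPt a₁ d₁ a₂ d₂ a₃ d₃ f x y z ∈ polytopeP1 a₁ (a₁ + d₁) a₂ (a₂ + d₂) a₃ (a₃ + d₃) ↔
      x ∈ Icc (0 : ℝ) 1 ∧ y ∈ Icc (0 : ℝ) 1 ∧ z ∈ Icc (0 : ℝ) 1 ∧
      f ∈ Icc (lowerP1 a₁ d₁ a₂ d₂ a₃ d₃ x y z) (upperP1 a₁ d₁ a₂ d₂ a₃ d₃ x y z) := by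
  have e : boxPt a₁ d₁ a₂ d₂ a₃ d₃ f x y z ∈ polytopeP1 a₁ (a₁ + d₁) a₂ (a₂ + d₂) a₃ (a₃ + d₃) ↔
      DoubleMcCormickSystem a₂ (a₂ + d₂) a₃ (a₃ + d₃) a₁ (a₁ + d₁) f (a₂ + d₂ * y) (a₃ + d₃ * z)
        (a₁ + d₁ * x) := Iff.rfl
  rw [e]
  have hk : 0 < d₂ * d₃ := by positivity
  constructor
  -- The last two inequalities of the system are implied by the others and are not needed here.
  · rintro ⟨g1, g2, g3, g4, g5, g6, g7, g8, g9, g10, g11, g12, g13, g14, -, -⟩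
    refine ⟨⟨?_, ?_⟩, ⟨?_, ?_⟩, ⟨?_, ?_⟩, ?_, ?_⟩
    · exact nonneg_of_mul_nonneg_right (by linarith) hd₁
    · exact le_of_mul_le_mul_left (by linarith) hd₁
    · exact nonneg_of_mul_nonneg_right (by linarith) hd₂
    · exact le_of_mul_le_mul_left (by linarith) hd₂
    · exact nonneg_of_mul_nonneg_right (by linarith) hd₃
    · exact le_of_mul_le_mul_left (by linarith) hd₃
    · unfold lowerP1 pairLower pairWidth
      rcases max_cases 0 (y + z - 1) with ⟨h, -⟩ | ⟨h, -⟩ <;> rw [h]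
      -- Isolating the outer `max` splits the bound into two facet inequalities.
      all_goals rw [add_comm, ← le_sub_iff_add_le, ← le_div_iff₀' hd₁, max_le_iff]
      all_goals rw [le_div_iff₀' hd₁, le_div_iff₀' hd₁]
      all_goals constructor <;> linarith
    · unfold upperP1 pairUpper pairWidth
      rcases min_cases y z with ⟨h, -⟩ | ⟨h, -⟩ <;> rw [h]
      all_goals rw [add_comm, ← sub_le_iff_le_add, ← div_le_iff₀' hd₁, le_min_iff]
      all_goals rw [div_le_iff₀' hd₁, div_le_iff₀' hd₁]
      all_goals constructor <;> linarith
  · rintro ⟨⟨hx0, hx1⟩, ⟨hy0, hy1⟩, ⟨hz0, hz1⟩, hL, hU⟩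
    have b1 : 0 ≤ d₁ * x := by positivity
    have b2 : 0 ≤ d₂ * y := by positivity
    have b3 : 0 ≤ d₃ * z := by positivity
    have c1 : d₁ * x ≤ d₁ * 1 := by gcongr
    have c2 : d₂ * y ≤ d₂ * 1 := by gcongr
    have c3 : d₃ * z ≤ d₃ * 1 := by gcongr
    have w1 : a₃ * d₂ * y + a₂ * d₃ * z ≤ pairLower a₂ d₂ a₃ d₃ y z := by
      have := mul_nonneg hk.le (le_max_left 0 (y + z - 1))
      unfold pairLower; linarith
    have w2 : a₃ * d₂ * y + a₂ * d₃ * z + d₂ * d₃ * (y + z - 1) ≤ pairLower a₂ d₂ a₃ d₃ y z := by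
      have := mul_le_mul_of_nonneg_left (le_max_right 0 (y + z - 1)) hk.le
      unfold pairLower; linarith
    have w3 : pairUpper a₂ d₂ a₃ d₃ y z ≤ a₃ * d₂ * y + a₂ * d₃ * z + d₂ * d₃ * y := by
      have := mul_le_mul_of_nonneg_left (min_le_left y z) hk.le
      unfold pairUpper; linarith
    have w4 : pairUpper a₂ d₂ a₃ d₃ y z ≤ a₃ * d₂ * y + a₂ * d₃ * z + d₂ * d₃ * z := by
      have := mul_le_mul_of_nonneg_left (min_le_right y z) hk.le
      unfold pairUpper; linarith
    have hl := pairLower_nonneg ha₂ hd₂ ha₃ hd₃ hy0 hz0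
    have hu := pairUpper_le_pairWidth ha₂ hd₂ ha₃ hd₃ hy1 hz1
    unfold lowerP1 at hL
    unfold upperP1 at hU
    set l := pairLower a₂ d₂ a₃ d₃ y z
    set u := pairUpper a₂ d₂ a₃ d₃ y z
    set W := pairWidth a₂ d₂ a₃ d₃ with hW
    have m1 := mul_nonneg hd₁.le (le_max_left 0 (l - W * (1 - x)))
    have m2 := mul_le_mul_of_nonneg_left (le_max_right 0 (l - W * (1 - x))) hd₁.le
    have m3 := mul_le_mul_of_nonneg_left (min_le_left u (W * x)) hd₁.le
    have m4 := mul_le_mul_of_nonneg_left (min_le_right u (W * x)) hd₁.le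
    have hb : 0 ≤ a₁ + d₁ := by positivity
    -- The envelope pieces enter the facets multiplied by `a₁` or by `b₁`, so `linarith` is given
    -- both families of products.
    have s1 := mul_le_mul_of_nonneg_left w1 ha₁
    have s2 := mul_le_mul_of_nonneg_left w2 ha₁
    have s3 := mul_le_mul_of_nonneg_left w3 ha₁
    have s4 := mul_le_mul_of_nonneg_left w4 ha₁
    have s1' := mul_le_mul_of_nonneg_left w1 hb
    have s2' := mul_le_mul_of_nonneg_left w2 hb
    have s3' := mul_le_mul_of_nonneg_left w3 hb
    have s4' := mul_le_mul_of_nonneg_left w4 hb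
    have s5 := mul_nonneg ha₁ hl
    have s6 := mul_le_mul_of_nonneg_left hu ha₁
    generalize max 0 (l - W * (1 - x)) = M at *
    generalize min u (W * x) = N at *
    rw [hW] at m2 m4 s6
    unfold pairWidth at m2 m4 s6
    refine ⟨?_, ?_, ?_, ?_, ?_, ?_, ?_, ?_, ?_, ?_, ?_, ?_, ?_, ?_, ?_, ?_⟩ <;> linarith

theorem upper_boxPt_mem_polytopeP1 (ha₁ : 0 ≤ a₁) (hd₁ : 0 < d₁) (ha₂ : 0 ≤ a₂) (hd₂ : 0 < d₂)
    (ha₃ : 0 ≤ a₃) (hd₃ : 0 < d₃) {f x y z : ℝ} (hx : x ∈ Icc (0 : ℝ) 1) (hy : y ∈ Icc (0 : ℝ) 1)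
    (hz : z ∈ Icc (0 : ℝ) 1) (hf : f = upperP1 a₁ d₁ a₂ d₂ a₃ d₃ x y z) :
    boxPt a₁ d₁ a₂ d₂ a₃ d₃ f x y z ∈ polytopeP1 a₁ (a₁ + d₁) a₂ (a₂ + d₂) a₃ (a₃ + d₃) := by
  rw [boxPt_mem_polytopeP1_iff ha₁ hd₁ ha₂ hd₂ ha₃ hd₃]
  exact ⟨hx, hy, hz, hf ▸ lowerP1_le_upperP1 ha₁ hd₁ ha₂ hd₂ ha₃ hd₃ hx hy hz, hf.le⟩

theorem lower_boxPt_mem_polytopeP1 (ha₁ : 0 ≤ a₁) (hd₁ : 0 < d₁) (ha₂ : 0 ≤ a₂) (hd₂ : 0 < d₂)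
    (ha₃ : 0 ≤ a₃) (hd₃ : 0 < d₃) {f x y z : ℝ} (hx : x ∈ Icc (0 : ℝ) 1) (hy : y ∈ Icc (0 : ℝ) 1)
    (hz : z ∈ Icc (0 : ℝ) 1) (hf : f = lowerP1 a₁ d₁ a₂ d₂ a₃ d₃ x y z) :
    boxPt a₁ d₁ a₂ d₂ a₃ d₃ f x y z ∈ polytopeP1 a₁ (a₁ + d₁) a₂ (a₂ + d₂) a₃ (a₃ + d₃) := by
  rw [boxPt_mem_polytopeP1_iff ha₁ hd₁ ha₂ hd₂ ha₃ hd₃]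
  exact ⟨hx, hy, hz, hf.ge, hf ▸ lowerP1_le_upperP1 ha₁ hd₁ ha₂ hd₂ ha₃ hd₃ hx hy hz⟩

end bounds

/-! ### The polytope `P_H` as a region between two graphs. -/

/-- The concave envelope of `x₁ x₂ x₃` on the box, at `xᵢ = aᵢ + dᵢ tᵢ`. -/
noncomputable def upperH (a₁ d₁ a₂ d₂ a₃ d₃ x y z : ℝ) : ℝ :=
  a₁ * a₂ * a₃ + d₁ * a₂ * a₃ * x + a₁ * d₂ * a₃ * y + a₁ * a₂ * d₃ * z + d₁ * d₂ * a₃ * min x y +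
    d₁ * a₂ * d₃ * min x z + a₁ * d₂ * d₃ * min y z + d₁ * d₂ * d₃ * min x (min y z)

/-- The convex envelope of `x₁ x₂ x₃` on the box, at `xᵢ = aᵢ + dᵢ tᵢ`, when
`a₁ / d₁` is the smallest of the `aᵢ / dᵢ`. -/
noncomputable def lowerH (a₁ d₁ a₂ d₂ a₃ d₃ x y z : ℝ) : ℝ :=
  a₁ * a₂ * a₃ + d₁ * a₂ * a₃ * x + a₁ * d₂ * a₃ * y + a₁ * a₂ * d₃ * z +
    a₁ * d₂ * d₃ * max 0 (x + y + z - 1) +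
    (d₁ * a₂ * d₃ - a₁ * d₂ * d₃) * max 0 (x + z - 1) +
    (d₁ * d₂ * a₃ - a₁ * d₂ * d₃) * max 0 (x + y - 1) +
    (a₁ * d₂ * d₃ + d₁ * d₂ * d₃) * max 0 (x + y + z - 2)

section hull

variable {a₁ d₁ a₂ d₂ a₃ d₃ : ℝ}

/-- This compares the `a₁ * d₂ * d₃` parts of `lowerH` and `upperH`; the hinges of `lowerH` with
negative sign are moved to the right. -/
theorem max_sub_one_add_max_sub_two_le {x y z : ℝ} (hx : x ∈ Icc (0 : ℝ) 1)
    (hy : y ∈ Icc (0 : ℝ) 1) (hz : z ∈ Icc (0 : ℝ) 1) :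
    max 0 (x + y + z - 1) + max 0 (x + y + z - 2) ≤
      max 0 (x + z - 1) + max 0 (x + y - 1) + min y z := by
  obtain ⟨hx0, hx1⟩ := hx
  obtain ⟨hy0, hy1⟩ := hy
  obtain ⟨hz0, hz1⟩ := hz
  have h1 := le_max_left 0 (x + z - 1)
  have h2 := le_max_right 0 (x + z - 1)
  have h3 := le_max_left 0 (x + y - 1)
  have h4 := le_max_right 0 (x + y - 1)
  rcases max_cases 0 (x + y + z - 1) with ⟨e1, _⟩ | ⟨e1, _⟩ <;>
  rcases max_cases 0 (x + y + z - 2) with ⟨e2, _⟩ | ⟨e2, _⟩ <;>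
  rcases min_cases y z with ⟨e3, _⟩ | ⟨e3, _⟩ <;> rw [e1, e2, e3] <;> linarith

theorem lowerH_le_upperH (ha₁ : 0 ≤ a₁) (hd₁ : 0 < d₁) (ha₂ : 0 ≤ a₂) (hd₂ : 0 < d₂)
    (ha₃ : 0 ≤ a₃) (hd₃ : 0 < d₃) {x y z : ℝ} (hx : x ∈ Icc (0 : ℝ) 1) (hy : y ∈ Icc (0 : ℝ) 1)
    (hz : z ∈ Icc (0 : ℝ) 1) :
    lowerH a₁ d₁ a₂ d₂ a₃ d₃ x y z ≤ upperH a₁ d₁ a₂ d₂ a₃ d₃ x y z := by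
  have h := max_sub_one_add_max_sub_two_le hx hy hz
  obtain ⟨hx0, hx1⟩ := hx
  obtain ⟨hy0, hy1⟩ := hy
  obtain ⟨hz0, hz1⟩ := hz
  have h12 : max 0 (x + y - 1) ≤ min x y :=
    max_le (le_min hx0 hy0) (le_min (by linarith) (by linarith))
  have h13 : max 0 (x + z - 1) ≤ min x z :=
    max_le (le_min hx0 hz0) (le_min (by linarith) (by linarith))
  have h123 : max 0 (x + y + z - 2) ≤ min x (min y z) :=
    max_le (le_min hx0 (le_min hy0 hz0))
      (le_min (by linarith) (le_min (by linarith) (by linarith)))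
  have m1 := mul_le_mul_of_nonneg_left h (by positivity : 0 ≤ a₁ * d₂ * d₃)
  have m2 := mul_le_mul_of_nonneg_left h12 (by positivity : 0 ≤ d₁ * d₂ * a₃)
  have m3 := mul_le_mul_of_nonneg_left h13 (by positivity : 0 ≤ d₁ * a₂ * d₃)
  have m4 := mul_le_mul_of_nonneg_left h123 (by positivity : 0 ≤ d₁ * d₂ * d₃)
  unfold lowerH upperH
  linarith

/-- On the cube only six sign patterns of the four hinges in `lowerH` can occur, one for each lower
facet. The upper facets correspond to the six orderings of `x, y, z`. Conversely, `h₂` and `h₃` make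
the hinge coefficients nonnegative, so each hinge may be replaced by either of its pieces. -/
theorem boxPt_mem_polytopeH_iff (ha₁ : 0 ≤ a₁) (hd₁ : 0 < d₁) (ha₂ : 0 ≤ a₂) (hd₂ : 0 < d₂)
    (ha₃ : 0 ≤ a₃) (hd₃ : 0 < d₃) (h₂ : a₁ * d₂ * d₃ ≤ d₁ * a₂ * d₃)
    (h₃ : a₁ * d₂ * d₃ ≤ d₁ * d₂ * a₃) (f x y z : ℝ) :
    boxPt a₁ d₁ a₂ d₂ a₃ d₃ f x y z ∈ polytopeH a₁ (a₁ + d₁) a₂ (a₂ + d₂) a₃ (a₃ + d₃) ↔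
      x ∈ Icc (0 : ℝ) 1 ∧ y ∈ Icc (0 : ℝ) 1 ∧ z ∈ Icc (0 : ℝ) 1 ∧
      f ∈ Icc (lowerH a₁ d₁ a₂ d₂ a₃ d₃ x y z) (upperH a₁ d₁ a₂ d₂ a₃ d₃ x y z) := by
  have e : boxPt a₁ d₁ a₂ d₂ a₃ d₃ f x y z ∈ polytopeH a₁ (a₁ + d₁) a₂ (a₂ + d₂) a₃ (a₃ + d₃) ↔
      HullSystem a₁ (a₁ + d₁) a₂ (a₂ + d₂) a₃ (a₃ + d₃) f (a₁ + d₁ * x) (a₂ + d₂ * y)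
        (a₃ + d₃ * z) := Iff.rfl
  -- The quotient splits so that its part free of `x` cancels against the constant term of the
  -- facet.
  have e5 (η : ℝ) : η / d₁ * (a₁ + d₁ * x) = η * a₁ / d₁ + η * x := by field_simp
  have e6 (η : ℝ) : η / -d₁ * (a₁ + d₁ * x) = η * (a₁ + d₁) / -d₁ + η * (1 - x) := by
    field_simp; ring
  rw [e]
  simp only [HullSystem, add_sub_cancel_left, sub_add_cancel_left, e5, e6]
  constructor
  · rintro ⟨g1, g2, g3, g4, g5, g6, k1, k2, k3, k4, k5, k6, r1, r2, r3, r4, r5, r6⟩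
    have hx0 : 0 ≤ x := nonneg_of_mul_nonneg_right (by linarith) hd₁
    have hx1 : x ≤ 1 := le_of_mul_le_mul_left (by linarith) hd₁
    have hy0 : 0 ≤ y := nonneg_of_mul_nonneg_right (by linarith) hd₂
    have hy1 : y ≤ 1 := le_of_mul_le_mul_left (by linarith) hd₂
    have hz0 : 0 ≤ z := nonneg_of_mul_nonneg_right (by linarith) hd₃
    have hz1 : z ≤ 1 := le_of_mul_le_mul_left (by linarith) hd₃
    refine ⟨⟨hx0, hx1⟩, ⟨hy0, hy1⟩, ⟨hz0, hz1⟩, ?_, ?_⟩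
    · unfold lowerH
      clear k1 k2 k3 k4 k5 k6 r1 r2 r3 r4 r5 r6 h₂ h₃ e
      rcases max_cases 0 (x + y + z - 1) with ⟨s1, _⟩ | ⟨s1, _⟩ <;>
      rcases max_cases 0 (x + z - 1) with ⟨s2, _⟩ | ⟨s2, _⟩ <;>
      rcases max_cases 0 (x + y - 1) with ⟨s3, _⟩ | ⟨s3, _⟩ <;>
      rcases max_cases 0 (x + y + z - 2) with ⟨s4, _⟩ | ⟨s4, _⟩ <;>
      rw [s1, s2, s3, s4] <;> linarith
    · unfold upperH
      clear g1 g2 g3 g4 g5 g6 r1 r2 r3 r4 r5 r6 h₂ h₃ e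
      rcases le_total x y with s1 | s1 <;> rcases le_total y z with s2 | s2 <;>
      rcases le_total x z with s3 | s3 <;>
      simp only [min_eq_left, min_eq_right, s1, s2, s3] <;> first
        -- The fallback serves the two cyclic choices of order, which force `x = y = z`.
        | linarith
        | (obtain rfl : x = y := by linarith
           obtain rfl : x = z := by linarith
           linarith)
  · rintro ⟨⟨hx0, hx1⟩, ⟨hy0, hy1⟩, ⟨hz0, hz1⟩, hL, hU⟩
    have b1 : 0 ≤ d₁ * x := by positivity
    have b2 : 0 ≤ d₂ * y := by positivity
    have b3 : 0 ≤ d₃ * z := by positivity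
    have b1' : d₁ * x ≤ d₁ * 1 := by gcongr
    have b2' : d₂ * y ≤ d₂ * 1 := by gcongr
    have b3' : d₃ * z ≤ d₃ * 1 := by gcongr
    have c1 : 0 ≤ a₁ * d₂ * d₃ := by positivity
    have c2 : 0 ≤ d₁ * a₂ * d₃ - a₁ * d₂ * d₃ := sub_nonneg.2 h₂
    have c3 : 0 ≤ d₁ * d₂ * a₃ - a₁ * d₂ * d₃ := sub_nonneg.2 h₃
    have c4 : 0 ≤ a₁ * d₂ * d₃ + d₁ * d₂ * d₃ := by positivity
    have c5 : 0 ≤ d₁ * d₂ * a₃ := by positivity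
    have c6 : 0 ≤ d₁ * a₂ * d₃ := by positivity
    have c7 : 0 ≤ d₁ * d₂ * d₃ := by positivity
    unfold lowerH at hL
    unfold upperH at hU
    have m1 := mul_nonneg c1 (le_max_left 0 (x + y + z - 1))
    have m2 := mul_nonneg c2 (le_max_left 0 (x + z - 1))
    have m3 := mul_nonneg c3 (le_max_left 0 (x + y - 1))
    have m4 := mul_nonneg c4 (le_max_left 0 (x + y + z - 2))
    have n1 := mul_le_mul_of_nonneg_left (le_max_right 0 (x + y + z - 1)) c1
    have n2 := mul_le_mul_of_nonneg_left (le_max_right 0 (x + z - 1)) c2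
    have n3 := mul_le_mul_of_nonneg_left (le_max_right 0 (x + y - 1)) c3
    have n4 := mul_le_mul_of_nonneg_left (le_max_right 0 (x + y + z - 2)) c4
    have p1 := mul_le_mul_of_nonneg_left (min_le_left x y) c5
    have p2 := mul_le_mul_of_nonneg_left (min_le_right x y) c5
    have p3 := mul_le_mul_of_nonneg_left (min_le_left x z) c6
    have p4 := mul_le_mul_of_nonneg_left (min_le_right x z) c6
    have p5 := mul_le_mul_of_nonneg_left (min_le_left y z) c1
    have p6 := mul_le_mul_of_nonneg_left (min_le_right y z) c1
    have p7 := mul_le_mul_of_nonneg_left (min_le_left x (min y z)) c7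
    have p8 := mul_le_mul_of_nonneg_left ((min_le_right x (min y z)).trans (min_le_left y z)) c7
    have p9 := mul_le_mul_of_nonneg_left ((min_le_right x (min y z)).trans (min_le_right y z)) c7
    clear e e5 e6 c1 c2 c3 c4 c5 c6 c7 h₂ h₃ hx0 hx1 hy0 hy1 hz0 hz1 hd₁ hd₂ hd₃ ha₁ ha₂ ha₃
    refine ⟨?_, ?_, ?_, ?_, ?_, ?_, ?_, ?_, ?_, ?_, ?_, ?_, ?_, ?_, ?_, ?_, ?_, ?_⟩
    -- In the six lower facets, `n` marks a hinge replaced by its linear piece and `m` one replaced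
    -- by zero.
    · linarith only [hL, m1, m2, m3, m4]
    · linarith only [hL, n1, n2, n3, n4]
    · linarith only [hL, n1, n2, m3, m4]
    · linarith only [hL, n1, m2, n3, m4]
    · linarith only [hL, n1, n2, n3, m4]
    · linarith only [hL, n1, m2, m3, m4]
    · linarith only [hU, p1, p2, p3, p4, p5, p6, p7, p8, p9]
    · linarith only [hU, p1, p2, p3, p4, p5, p6, p7, p8, p9]
    · linarith only [hU, p1, p2, p3, p4, p5, p6, p7, p8, p9]
    · linarith only [hU, p1, p2, p3, p4, p5, p6, p7, p8, p9]
    · linarith only [hU, p1, p2, p3, p4, p5, p6, p7, p8, p9]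
    · linarith only [hU, p1, p2, p3, p4, p5, p6, p7, p8, p9]
    all_goals linarith only [b1, b2, b3, b1', b2', b3']

end hull

/-! ### `P₁` lies in the convex hull of the listed points. -/

section extreme

variable {a₁ d₁ a₂ d₂ a₃ d₃ : ℝ} {K : Set (Fin 4 → ℝ)}

theorem Convex.boxPt_combo₂ (hK : Convex ℝ K) {f g x x' y z t : ℝ}
    (h₁ : boxPt a₁ d₁ a₂ d₂ a₃ d₃ f x y z ∈ K) (h₂ : boxPt a₁ d₁ a₂ d₂ a₃ d₃ g x' y z ∈ K)
    (h0 : 0 ≤ t) (h1 : t ≤ 1) :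
    boxPt a₁ d₁ a₂ d₂ a₃ d₃ ((1 - t) * f + t * g) ((1 - t) * x + t * x') y z ∈ K := by
  convert hK h₁ h₂ (sub_nonneg.2 h1) h0 (by ring) using 1
  ext i
  fin_cases i <;> simp [boxPt] <;> ring

theorem Convex.boxPt_combo₃ (hK : Convex ℝ K) {f₁ f₂ f₃ x₁ x₂ x₃ y₁ y₂ y₃ z₁ z₂ z₃ r s t : ℝ}
    (h₁ : boxPt a₁ d₁ a₂ d₂ a₃ d₃ f₁ x₁ y₁ z₁ ∈ K) (h₂ : boxPt a₁ d₁ a₂ d₂ a₃ d₃ f₂ x₂ y₂ z₂ ∈ K)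
    (h₃ : boxPt a₁ d₁ a₂ d₂ a₃ d₃ f₃ x₃ y₃ z₃ ∈ K) (hr : 0 ≤ r) (hs : 0 ≤ s) (ht : 0 ≤ t)
    (hrst : r + s + t = 1) {f x y z : ℝ} (hf : f = r * f₁ + s * f₂ + t * f₃)
    (hx : x = r * x₁ + s * x₂ + t * x₃) (hy : y = r * y₁ + s * y₂ + t * y₃)
    (hz : z = r * z₁ + s * z₂ + t * z₃) : boxPt a₁ d₁ a₂ d₂ a₃ d₃ f x y z ∈ K := by
  have := hK.sum_mem (t := Finset.univ) (w := ![r, s, t])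
    (z := ![boxPt a₁ d₁ a₂ d₂ a₃ d₃ f₁ x₁ y₁ z₁, boxPt a₁ d₁ a₂ d₂ a₃ d₃ f₂ x₂ y₂ z₂,
      boxPt a₁ d₁ a₂ d₂ a₃ d₃ f₃ x₃ y₃ z₃])
    (by intro i _; fin_cases i <;> simpa) (by simpa [Fin.sum_univ_three] using hrst)
    (by intro i _; fin_cases i <;> simpa)
  convert this using 1
  have ht : t = 1 - r - s := by linarith
  subst hf hx hy hz ht
  ext i
  fin_cases i <;> simp [boxPt, Fin.sum_univ_three] <;> ring

theorem exists_convex_combo {p q x : ℝ} (hp : p ≤ x) (hq : x ≤ q) :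
    ∃ t, 0 ≤ t ∧ t ≤ 1 ∧ x = (1 - t) * p + t * q := by
  have : x ∈ segment ℝ p q := by
    rw [segment_eq_Icc (hp.trans hq)]; exact ⟨hp, hq⟩
  obtain ⟨r, s, hr, hs, hrs, h⟩ := this
  refine ⟨s, hs, by linarith, ?_⟩
  rw [← h, ← hrs]
  simp

/-- Over a fixed `(y, z)` the upper bound is linear in `x` on either side of `x₀ = u / W`, so its
values at `0`, `x₀` and `1` generate the whole graph. -/
theorem Convex.upper_line_mem (hK : Convex ℝ K) {u W A x₀ y z : ℝ} (hW : 0 < W)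
    (hx₀ : W * x₀ = u) (h0 : boxPt a₁ d₁ a₂ d₂ a₃ d₃ (a₁ * (A + u)) 0 y z ∈ K)
    (hm : boxPt a₁ d₁ a₂ d₂ a₃ d₃ (a₁ * A + d₁ * A * x₀ + a₁ * u + d₁ * u) x₀ y z ∈ K)
    (h1 : boxPt a₁ d₁ a₂ d₂ a₃ d₃ ((a₁ + d₁) * (A + u)) 1 y z ∈ K) {x : ℝ}
    (hx : x ∈ Icc (0 : ℝ) 1) :
    boxPt a₁ d₁ a₂ d₂ a₃ d₃ (a₁ * A + d₁ * A * x + a₁ * u + d₁ * min u (W * x)) x y z ∈ K := by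
  rcases le_total x x₀ with h | h
  · obtain ⟨t, ht0, ht1, e⟩ := exists_convex_combo hx.1 h
    rw [min_eq_right (by rw [← hx₀]; gcongr)]
    convert hK.boxPt_combo₂ h0 hm ht0 ht1 using 1
    rw [e, ← hx₀]
    congr 1
    ring
  · obtain ⟨t, ht0, ht1, e⟩ := exists_convex_combo h hx.2
    rw [min_eq_left (by rw [← hx₀]; gcongr)]
    convert hK.boxPt_combo₂ hm h1 ht0 ht1 using 1
    rw [e]
    congr 1
    ring

theorem Convex.lower_line_mem (hK : Convex ℝ K) {l W A x₀ y z : ℝ} (hW : 0 < W)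
    (hx₀ : W * (1 - x₀) = l) (h0 : boxPt a₁ d₁ a₂ d₂ a₃ d₃ (a₁ * (A + l)) 0 y z ∈ K)
    (hm : boxPt a₁ d₁ a₂ d₂ a₃ d₃ (a₁ * A + d₁ * A * x₀ + a₁ * l) x₀ y z ∈ K)
    (h1 : boxPt a₁ d₁ a₂ d₂ a₃ d₃ ((a₁ + d₁) * (A + l)) 1 y z ∈ K) {x : ℝ}
    (hx : x ∈ Icc (0 : ℝ) 1) :
    boxPt a₁ d₁ a₂ d₂ a₃ d₃ (a₁ * A + d₁ * A * x + a₁ * l + d₁ * max 0 (l - W * (1 - x))) x y z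
      ∈ K := by
  rcases le_total x x₀ with h | h
  · obtain ⟨t, ht0, ht1, e⟩ := exists_convex_combo hx.1 h
    rw [max_eq_left (by rw [← hx₀, sub_nonpos]; gcongr)]
    convert hK.boxPt_combo₂ h0 hm ht0 ht1 using 1
    rw [e]
    congr 1
    ring
  · obtain ⟨t, ht0, ht1, e⟩ := exists_convex_combo h hx.2
    rw [max_eq_right (by rw [← hx₀, sub_nonneg]; gcongr)]
    convert hK.boxPt_combo₂ hm h1 ht0 ht1 using 1
    rw [e, ← hx₀]
    congr 1
    ring

theorem vec_four_congr {p q r s p' q' r' s' : ℝ} (hp : p = p') (hq : q = q') (hr : r = r')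
    (hs : s = s') : (![p, q, r, s] : Fin 4 → ℝ) = ![p', q', r', s'] := by
  rw [hp, hq, hr, hs]

theorem boxPoints_eq (a₁ d₁ a₂ d₂ a₃ d₃ : ℝ) :
    boxPoints a₁ (a₁ + d₁) a₂ (a₂ + d₂) a₃ (a₃ + d₃) =
      {boxPt a₁ d₁ a₂ d₂ a₃ d₃ ((a₁ + d₁) * (a₂ * a₃ + 0)) 1 0 0,
       boxPt a₁ d₁ a₂ d₂ a₃ d₃ (a₁ * (a₂ * a₃ + 0)) 0 0 0,
       boxPt a₁ d₁ a₂ d₂ a₃ d₃ (a₁ * (a₂ * a₃ + a₂ * d₃)) 0 0 1,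
       boxPt a₁ d₁ a₂ d₂ a₃ d₃ (a₁ * (a₂ * a₃ + a₃ * d₂)) 0 1 0,
       boxPt a₁ d₁ a₂ d₂ a₃ d₃ (a₁ * (a₂ * a₃ + pairWidth a₂ d₂ a₃ d₃)) 0 1 1,
       boxPt a₁ d₁ a₂ d₂ a₃ d₃ ((a₁ + d₁) * (a₂ * a₃ + pairWidth a₂ d₂ a₃ d₃)) 1 1 1,
       boxPt a₁ d₁ a₂ d₂ a₃ d₃ ((a₁ + d₁) * (a₂ * a₃ + a₃ * d₂)) 1 1 0,
       boxPt a₁ d₁ a₂ d₂ a₃ d₃ ((a₁ + d₁) * (a₂ * a₃ + a₂ * d₃)) 1 0 1} := by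
  refine congrArg₂ insert ?_ (congrArg₂ insert ?_ (congrArg₂ insert ?_ (congrArg₂ insert ?_
    (congrArg₂ insert ?_ (congrArg₂ insert ?_ (congrArg₂ insert ?_ (congrArg singleton ?_)))))))
  all_goals refine vec_four_congr ?_ ?_ ?_ ?_ <;> (try unfold pairWidth) <;> ring

theorem extraPoints1_eq (a₁ d₁ a₂ d₂ a₃ d₃ : ℝ) (hW : pairWidth a₂ d₂ a₃ d₃ ≠ 0) :
    extraPoints1 a₁ (a₁ + d₁) a₂ (a₂ + d₂) a₃ (a₃ + d₃) =
      {boxPt a₁ d₁ a₂ d₂ a₃ d₃ (a₁ * (a₂ * a₃) +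
          d₁ * (a₂ * a₃) * (a₂ * d₃ / pairWidth a₂ d₂ a₃ d₃) + a₁ * (a₂ * d₃) + d₁ * (a₂ * d₃))
          (a₂ * d₃ / pairWidth a₂ d₂ a₃ d₃) 0 1,
       boxPt a₁ d₁ a₂ d₂ a₃ d₃ (a₁ * (a₂ * a₃) +
          d₁ * (a₂ * a₃) * (a₃ * d₂ / pairWidth a₂ d₂ a₃ d₃) + a₁ * (a₃ * d₂) + d₁ * (a₃ * d₂))
          (a₃ * d₂ / pairWidth a₂ d₂ a₃ d₃) 1 0,
       boxPt a₁ d₁ a₂ d₂ a₃ d₃ (a₁ * (a₂ * a₃) +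
          d₁ * (a₂ * a₃) * ((a₂ + d₂) * d₃ / pairWidth a₂ d₂ a₃ d₃) + a₁ * (a₃ * d₂))
          ((a₂ + d₂) * d₃ / pairWidth a₂ d₂ a₃ d₃) 1 0,
       boxPt a₁ d₁ a₂ d₂ a₃ d₃ (a₁ * (a₂ * a₃) +
          d₁ * (a₂ * a₃) * ((a₃ + d₃) * d₂ / pairWidth a₂ d₂ a₃ d₃) + a₁ * (a₂ * d₃))
          ((a₃ + d₃) * d₂ / pairWidth a₂ d₂ a₃ d₃) 0 1} := by
  have e : (a₂ + d₂) * (a₃ + d₃) - a₂ * a₃ = pairWidth a₂ d₂ a₃ d₃ := rfl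
  simp only [extraPoints1, e]
  generalize hg : pairWidth a₂ d₂ a₃ d₃ = W at *
  unfold pairWidth at hg
  refine congrArg₂ insert ?_ (congrArg₂ insert ?_ (congrArg₂ insert ?_ (congrArg singleton ?_)))
  all_goals refine vec_four_congr ?_ ?_ ?_ ?_ <;> field_simp <;> subst hg <;> ring

end extreme

section extreme

variable {a₁ d₁ a₂ d₂ a₃ d₃ : ℝ} {K : Set (Fin 4 → ℝ)}

theorem polytopeP1_subset_of_convex (ha₁ : 0 ≤ a₁) (hd₁ : 0 < d₁) (ha₂ : 0 ≤ a₂) (hd₂ : 0 < d₂)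
    (ha₃ : 0 ≤ a₃) (hd₃ : 0 < d₃) (hK : Convex ℝ K)
    (hV : boxPoints a₁ (a₁ + d₁) a₂ (a₂ + d₂) a₃ (a₃ + d₃) ∪
      extraPoints1 a₁ (a₁ + d₁) a₂ (a₂ + d₂) a₃ (a₃ + d₃) ⊆ K) :
    polytopeP1 a₁ (a₁ + d₁) a₂ (a₂ + d₂) a₃ (a₃ + d₃) ⊆ K := by
  have hW := pairWidth_pos ha₂ hd₂ ha₃ hd₃
  rw [boxPoints_eq, extraPoints1_eq _ _ _ _ _ _ hW.ne'] at hV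
  simp only [union_subset_iff, insert_subset_iff, singleton_subset_iff] at hV
  obtain ⟨⟨v100, v000, v001, v010, v011, v111, v110, v101⟩, e1, e2, e3, e4⟩ := hV
  intro p hp
  obtain ⟨f, x, y, z, rfl⟩ := exists_eq_boxPt (a₁ := a₁) (a₂ := a₂) (a₃ := a₃) hd₁ hd₂ hd₃ p
  rw [boxPt_mem_polytopeP1_iff ha₁ hd₁ ha₂ hd₂ ha₃ hd₃] at hp
  obtain ⟨hx, ⟨hy0, hy1⟩, ⟨hz0, hz1⟩, hL, hU⟩ := hp
  have hWe : pairWidth a₂ d₂ a₃ d₃ = a₃ * d₂ + a₂ * d₃ + d₂ * d₃ := by unfold pairWidth; ring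
  have q1 := mul_div_cancel₀ (a₂ * d₃) hW.ne'
  have q2 := mul_div_cancel₀ (a₃ * d₂) hW.ne'
  have q3 := mul_div_cancel₀ ((a₂ + d₂) * d₃) hW.ne'
  have q4 := mul_div_cancel₀ ((a₃ + d₃) * d₂) hW.ne'
  have hupper : boxPt a₁ d₁ a₂ d₂ a₃ d₃ (upperP1 a₁ d₁ a₂ d₂ a₃ d₃ x y z) x y z ∈ K := by
    unfold upperP1
    rcases le_total y z with h | h
    -- The barycentric weights in the triangle `(0,0), (0,1), (1,1)` are `1 - z`, `z - y`, `y`;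
    -- there `pairUpper` takes the values `0`, `a₂ d₃`, `W`, with breaks at `0`, `a₂ d₃ / W`, `1`.
    · have hu : pairUpper a₂ d₂ a₃ d₃ y z = (z - y) * (a₂ * d₃) + y * pairWidth a₂ d₂ a₃ d₃ := by
        rw [hWe, pairUpper, min_eq_left h]; ring
      rw [hu]
      generalize pairWidth a₂ d₂ a₃ d₃ = W at *
      refine hK.upper_line_mem (x₀ := (z - y) * (a₂ * d₃ / W) + y) hW
        (by linear_combination (z - y) * q1) ?_ ?_ ?_ hx
      · refine hK.boxPt_combo₃ v000 v001 v011 (sub_nonneg.2 hz1) (sub_nonneg.2 h) hy0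
          (by ring) ?_ ?_ ?_ ?_ <;> ring
      · refine hK.boxPt_combo₃ v000 e1 v111 (sub_nonneg.2 hz1) (sub_nonneg.2 h) hy0
          (by ring) ?_ ?_ ?_ ?_ <;> ring
      · refine hK.boxPt_combo₃ v100 v101 v111 (sub_nonneg.2 hz1) (sub_nonneg.2 h) hy0
          (by ring) ?_ ?_ ?_ ?_ <;> ring
    · have hu : pairUpper a₂ d₂ a₃ d₃ y z = (y - z) * (a₃ * d₂) + z * pairWidth a₂ d₂ a₃ d₃ := by
        rw [hWe, pairUpper, min_eq_right h]; ring
      rw [hu]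
      generalize pairWidth a₂ d₂ a₃ d₃ = W at *
      refine hK.upper_line_mem (x₀ := (y - z) * (a₃ * d₂ / W) + z) hW
        (by linear_combination (y - z) * q2) ?_ ?_ ?_ hx
      · refine hK.boxPt_combo₃ v000 v010 v011 (sub_nonneg.2 hy1) (sub_nonneg.2 h) hz0
          (by ring) ?_ ?_ ?_ ?_ <;> ring
      · refine hK.boxPt_combo₃ v000 e2 v111 (sub_nonneg.2 hy1) (sub_nonneg.2 h) hz0
          (by ring) ?_ ?_ ?_ ?_ <;> ring
      · refine hK.boxPt_combo₃ v100 v110 v111 (sub_nonneg.2 hy1) (sub_nonneg.2 h) hz0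
          (by ring) ?_ ?_ ?_ ?_ <;> ring
  have hlower : boxPt a₁ d₁ a₂ d₂ a₃ d₃ (lowerP1 a₁ d₁ a₂ d₂ a₃ d₃ x y z) x y z ∈ K := by
    unfold lowerP1
    rcases le_total (y + z) 1 with h | h
    · have h' : 0 ≤ 1 - y - z := by linarith
      -- For the lower bound the square is cut along `y + z = 1`. The break lies at `x = 1` over
      -- `(0,0)` and at `x = 0` over `(1,1)`.
      have hl : pairLower a₂ d₂ a₃ d₃ y z = y * (a₃ * d₂) + z * (a₂ * d₃) := by
        rw [pairLower, max_eq_left (by linarith)]; ring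
      rw [hl]
      generalize pairWidth a₂ d₂ a₃ d₃ = W at *
      refine hK.lower_line_mem
        (x₀ := (1 - y - z) + y * ((a₂ + d₂) * d₃ / W) + z * ((a₃ + d₃) * d₂ / W)) hW
        (by linear_combination (-y) * q3 - z * q4 + (y + z) * hWe) ?_ ?_ ?_ hx
      · refine hK.boxPt_combo₃ v000 v010 v001 h' hy0 hz0
          (by ring) ?_ ?_ ?_ ?_ <;> ring
      · refine hK.boxPt_combo₃ v100 e3 e4 h' hy0 hz0
          (by ring) ?_ ?_ ?_ ?_ <;> ring
      · refine hK.boxPt_combo₃ v100 v110 v101 h' hy0 hz0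
          (by ring) ?_ ?_ ?_ ?_ <;> ring
    · have h' : 0 ≤ y + z - 1 := by linarith
      have hl : pairLower a₂ d₂ a₃ d₃ y z = (1 - z) * (a₃ * d₂) + (1 - y) * (a₂ * d₃) +
          (y + z - 1) * pairWidth a₂ d₂ a₃ d₃ := by
        rw [hWe, pairLower, max_eq_right h']; ring
      rw [hl]
      generalize pairWidth a₂ d₂ a₃ d₃ = W at *
      refine hK.lower_line_mem
        (x₀ := (1 - z) * ((a₂ + d₂) * d₃ / W) + (1 - y) * ((a₃ + d₃) * d₂ / W)) hW
        (by linear_combination (-(1 - z)) * q3 - (1 - y) * q4 + (2 - y - z) * hWe) ?_ ?_ ?_ hx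
      · refine hK.boxPt_combo₃ v010 v001 v011 (sub_nonneg.2 hz1) (sub_nonneg.2 hy1) h'
          (by ring) ?_ ?_ ?_ ?_ <;> ring
      · refine hK.boxPt_combo₃ e3 e4 v011 (sub_nonneg.2 hz1) (sub_nonneg.2 hy1) h'
          (by ring) ?_ ?_ ?_ ?_ <;> ring
      · refine hK.boxPt_combo₃ v110 v101 v111 (sub_nonneg.2 hz1) (sub_nonneg.2 hy1) h'
          (by ring) ?_ ?_ ?_ ?_ <;> ring
  -- The point lies on the vertical segment between the two graphs.
  obtain ⟨t, ht0, ht1, e⟩ := exists_convex_combo hL hU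
  convert hK.boxPt_combo₂ hlower hupper ht0 ht1 using 1
  rw [e]
  congr 1
  ring

/-! ### Convexity of `P₁` and extremality of the listed points. -/

theorem add_mul_nonneg_of_eq {s t p q r : ℝ} (hs : 0 ≤ s) (ht : 0 ≤ t) (hp : 0 ≤ p) (hq : 0 ≤ q)
    (h : r = s * p + t * q) : 0 ≤ r := by
  rw [h]; positivity

theorem convex_polytopeP1 (a₁ b₁ a₂ b₂ a₃ b₃ : ℝ) : Convex ℝ (polytopeP1 a₁ b₁ a₂ b₂ a₃ b₃) := by
  rintro p ⟨g0, g1, g2, g3, g4, g5, g6, g7, g8, g9,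
    g10, g11, g12, g13, g14, g15⟩ q ⟨k0, k1, k2, k3, k4, k5, k6, k7, k8, k9,
    k10, k11, k12, k13, k14, k15⟩ s t hs ht hst
  obtain rfl : t = 1 - s := by linarith
  refine ⟨?_, ?_, ?_, ?_, ?_, ?_, ?_, ?_, ?_, ?_, ?_, ?_, ?_, ?_, ?_, ?_⟩ <;>
    simp only [Pi.add_apply, Pi.smul_apply, smul_eq_mul]
  · exact add_mul_nonneg_of_eq hs ht g0 k0 (by ring)
  · exact add_mul_nonneg_of_eq hs ht g1 k1 (by ring)
  · exact add_mul_nonneg_of_eq hs ht g2 k2 (by ring)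
  · exact add_mul_nonneg_of_eq hs ht g3 k3 (by ring)
  · exact add_mul_nonneg_of_eq hs ht g4 k4 (by ring)
  · exact add_mul_nonneg_of_eq hs ht g5 k5 (by ring)
  · exact add_mul_nonneg_of_eq hs ht g6 k6 (by ring)
  · exact add_mul_nonneg_of_eq hs ht g7 k7 (by ring)
  · exact add_mul_nonneg_of_eq hs ht g8 k8 (by ring)
  · exact add_mul_nonneg_of_eq hs ht g9 k9 (by ring)
  · exact add_mul_nonneg_of_eq hs ht g10 k10 (by ring)
  · exact add_mul_nonneg_of_eq hs ht g11 k11 (by ring)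
  · exact add_mul_nonneg_of_eq hs ht g12 k12 (by ring)
  · exact add_mul_nonneg_of_eq hs ht g13 k13 (by ring)
  · exact add_mul_nonneg_of_eq hs ht g14 k14 (by ring)
  · exact add_mul_nonneg_of_eq hs ht g15 k15 (by ring)

theorem eq_of_combo_of_le {s t p q c : ℝ} (hs : 0 < s) (ht : 0 < t) (hst : s + t = 1)
    (h : s * p + t * q = c) (hp : p ≤ c) (hq : q ≤ c) : p = c := by
  refine le_antisymm hp (le_of_mul_le_mul_left ?_ hs)
  have := mul_le_mul_of_nonneg_left hq ht.le
  obtain rfl : t = 1 - s := by linarith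
  linarith

theorem eq_of_combo_of_ge {s t p q c : ℝ} (hs : 0 < s) (ht : 0 < t) (hst : s + t = 1)
    (h : s * p + t * q = c) (hp : c ≤ p) (hq : c ≤ q) : p = c := by
  have := eq_of_combo_of_le hs ht hst (p := -p) (q := -q) (c := -c) (by linarith) (by linarith)
    (by linarith)
  linarith

theorem boxPt_mem_extremePoints (hd₁ : 0 < d₁) (hd₂ : 0 < d₂) (hd₃ : 0 < d₃) {f x y z : ℝ}
    (hmem : boxPt a₁ d₁ a₂ d₂ a₃ d₃ f x y z ∈ K)
    (h : ∀ s t f₁ x₁ y₁ z₁ f₂ x₂ y₂ z₂ : ℝ, 0 < s → 0 < t → s + t = 1 →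
      boxPt a₁ d₁ a₂ d₂ a₃ d₃ f₁ x₁ y₁ z₁ ∈ K → boxPt a₁ d₁ a₂ d₂ a₃ d₃ f₂ x₂ y₂ z₂ ∈ K →
      s * f₁ + t * f₂ = f → s * x₁ + t * x₂ = x → s * y₁ + t * y₂ = y → s * z₁ + t * z₂ = z →
      f₁ = f ∧ x₁ = x ∧ y₁ = y ∧ z₁ = z) :
    boxPt a₁ d₁ a₂ d₂ a₃ d₃ f x y z ∈ K.extremePoints ℝ := by
  rw [mem_extremePoints_iff_left]
  refine ⟨hmem, ?_⟩
  rintro p hp q hq ⟨s, t, hs, ht, hst, e⟩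
  obtain ⟨f₁, x₁, y₁, z₁, rfl⟩ := exists_eq_boxPt (a₁ := a₁) (a₂ := a₂) (a₃ := a₃) hd₁ hd₂ hd₃ p
  obtain ⟨f₂, x₂, y₂, z₂, rfl⟩ := exists_eq_boxPt (a₁ := a₁) (a₂ := a₂) (a₃ := a₃) hd₁ hd₂ hd₃ q
  obtain rfl : t = 1 - s := by linarith
  have e0 := congrFun e 0
  have e1 := congrFun e 1
  have e2 := congrFun e 2
  have e3 := congrFun e 3
  simp [boxPt] at e0 e1 e2 e3
  obtain ⟨rfl, rfl, rfl, rfl⟩ := h s (1 - s) f₁ x₁ y₁ z₁ f₂ x₂ y₂ z₂ hs ht hst hp hq e0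
    (mul_left_cancel₀ hd₁.ne' (by linarith)) (mul_left_cancel₀ hd₂.ne' (by linarith))
    (mul_left_cancel₀ hd₃.ne' (by linarith))
  rfl

theorem eq_of_combo_of_endpoint {s t p q c : ℝ} (hs : 0 < s) (ht : 0 < t) (hst : s + t = 1)
    (h : s * p + t * q = c) (hp : p ∈ Icc (0 : ℝ) 1) (hq : q ∈ Icc (0 : ℝ) 1)
    (hc : c = 0 ∨ c = 1) : p = c ∧ q = c := by
  have h' : t * q + s * p = c := by linarith
  have hst' : t + s = 1 := by linarith
  rcases hc with rfl | rfl
  · exact ⟨eq_of_combo_of_ge hs ht hst h hp.1 hq.1, eq_of_combo_of_ge ht hs hst' h' hq.1 hp.1⟩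
  · exact ⟨eq_of_combo_of_le hs ht hst h hp.2 hq.2, eq_of_combo_of_le ht hs hst' h' hq.2 hp.2⟩

/-- A cube vertex is extreme in the cube, and the fibre above it is a single point when the two
bounds agree. -/
theorem corner_mem_extremePoints (ha₁ : 0 ≤ a₁) (hd₁ : 0 < d₁) (ha₂ : 0 ≤ a₂) (hd₂ : 0 < d₂)
    (ha₃ : 0 ≤ a₃) (hd₃ : 0 < d₃) {f x y z : ℝ} (hx : x = 0 ∨ x = 1) (hy : y = 0 ∨ y = 1)
    (hz : z = 0 ∨ z = 1) (hL : lowerP1 a₁ d₁ a₂ d₂ a₃ d₃ x y z = f)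
    (hU : upperP1 a₁ d₁ a₂ d₂ a₃ d₃ x y z = f) :
    boxPt a₁ d₁ a₂ d₂ a₃ d₃ f x y z ∈
      (polytopeP1 a₁ (a₁ + d₁) a₂ (a₂ + d₂) a₃ (a₃ + d₃)).extremePoints ℝ := by
  have hI : ∀ {t : ℝ}, t = 0 ∨ t = 1 → t ∈ Icc (0 : ℝ) 1 := by
    rintro t (rfl | rfl) <;> simp
  refine boxPt_mem_extremePoints hd₁ hd₂ hd₃
    (upper_boxPt_mem_polytopeP1 ha₁ hd₁ ha₂ hd₂ ha₃ hd₃ (hI hx) (hI hy) (hI hz) hU.symm) ?_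
  intro s t f₁ x₁ y₁ z₁ f₂ x₂ y₂ z₂ hs ht hst h₁ h₂ ef ex ey ez
  rw [boxPt_mem_polytopeP1_iff ha₁ hd₁ ha₂ hd₂ ha₃ hd₃] at h₁ h₂
  obtain ⟨rfl, -⟩ := eq_of_combo_of_endpoint hs ht hst ex h₁.1 h₂.1 hx
  obtain ⟨rfl, -⟩ := eq_of_combo_of_endpoint hs ht hst ey h₁.2.1 h₂.2.1 hy
  obtain ⟨rfl, -⟩ := eq_of_combo_of_endpoint hs ht hst ez h₁.2.2.1 h₂.2.2.1 hz
  rw [hL, hU] at h₁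
  exact ⟨le_antisymm h₁.2.2.2.2 h₁.2.2.2.1, rfl, rfl, rfl⟩

theorem corner_zero_mem_extremePoints (ha₁ : 0 ≤ a₁) (hd₁ : 0 < d₁) (ha₂ : 0 ≤ a₂) (hd₂ : 0 < d₂)
    (ha₃ : 0 ≤ a₃) (hd₃ : 0 < d₃) {w y z : ℝ} (hy : y = 0 ∨ y = 1) (hz : z = 0 ∨ z = 1)
    (hl : pairLower a₂ d₂ a₃ d₃ y z = w) (hu : pairUpper a₂ d₂ a₃ d₃ y z = w) :
    boxPt a₁ d₁ a₂ d₂ a₃ d₃ (a₁ * (a₂ * a₃ + w)) 0 y z ∈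
      (polytopeP1 a₁ (a₁ + d₁) a₂ (a₂ + d₂) a₃ (a₃ + d₃)).extremePoints ℝ := by
  have hI : ∀ {t : ℝ}, t = 0 ∨ t = 1 → t ∈ Icc (0 : ℝ) 1 := by
    rintro t (rfl | rfl) <;> simp
  have h0 := hu ▸ pairUpper_nonneg ha₂ hd₂ ha₃ hd₃ (hI hy).1 (hI hz).1
  have h1 := hu ▸ pairUpper_le_pairWidth ha₂ hd₂ ha₃ hd₃ (hI hy).2 (hI hz).2
  refine corner_mem_extremePoints ha₁ hd₁ ha₂ hd₂ ha₃ hd₃ (by simp) hy hz ?_ ?_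
  · rw [lowerP1, hl, max_eq_left (by linarith)]
    ring
  · rw [upperP1, hu, min_eq_right (by linarith)]
    ring

theorem corner_one_mem_extremePoints (ha₁ : 0 ≤ a₁) (hd₁ : 0 < d₁) (ha₂ : 0 ≤ a₂) (hd₂ : 0 < d₂)
    (ha₃ : 0 ≤ a₃) (hd₃ : 0 < d₃) {w y z : ℝ} (hy : y = 0 ∨ y = 1) (hz : z = 0 ∨ z = 1)
    (hl : pairLower a₂ d₂ a₃ d₃ y z = w) (hu : pairUpper a₂ d₂ a₃ d₃ y z = w) :
    boxPt a₁ d₁ a₂ d₂ a₃ d₃ ((a₁ + d₁) * (a₂ * a₃ + w)) 1 y z ∈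
      (polytopeP1 a₁ (a₁ + d₁) a₂ (a₂ + d₂) a₃ (a₃ + d₃)).extremePoints ℝ := by
  have hI : ∀ {t : ℝ}, t = 0 ∨ t = 1 → t ∈ Icc (0 : ℝ) 1 := by
    rintro t (rfl | rfl) <;> simp
  have h0 := hu ▸ pairUpper_nonneg ha₂ hd₂ ha₃ hd₃ (hI hy).1 (hI hz).1
  have h1 := hu ▸ pairUpper_le_pairWidth ha₂ hd₂ ha₃ hd₃ (hI hy).2 (hI hz).2
  refine corner_mem_extremePoints ha₁ hd₁ ha₂ hd₂ ha₃ hd₃ (by simp) hy hz ?_ ?_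
  · rw [lowerP1, hl, max_eq_right (by linarith)]
    ring
  · rw [upperP1, hu, min_eq_left (by linarith)]
    ring

/-- In a segment through the point, both ends stay on the same edge of the cube. The bound on `f -
d₁ a₂ a₃ x` is attained at the point, hence at both ends, which forces each `x` to be at least `u /
W`; their average is `u / W`, so they coincide. This also covers breaks at an end of the edge, as
when `a₂ = 0`. -/
theorem upper_edge_mem_extremePoints (ha₁ : 0 ≤ a₁) (hd₁ : 0 < d₁) (ha₂ : 0 ≤ a₂) (hd₂ : 0 < d₂)
    (ha₃ : 0 ≤ a₃) (hd₃ : 0 < d₃) {u y z : ℝ} (hy : y = 0 ∨ y = 1) (hz : z = 0 ∨ z = 1)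
    (hu : pairUpper a₂ d₂ a₃ d₃ y z = u) :
    boxPt a₁ d₁ a₂ d₂ a₃ d₃ (a₁ * (a₂ * a₃) + d₁ * (a₂ * a₃) * (u / pairWidth a₂ d₂ a₃ d₃) +
      a₁ * u + d₁ * u) (u / pairWidth a₂ d₂ a₃ d₃) y z ∈
      (polytopeP1 a₁ (a₁ + d₁) a₂ (a₂ + d₂) a₃ (a₃ + d₃)).extremePoints ℝ := by
  have hI : ∀ {t : ℝ}, t = 0 ∨ t = 1 → t ∈ Icc (0 : ℝ) 1 := by
    rintro t (rfl | rfl) <;> simp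
  have hW := pairWidth_pos ha₂ hd₂ ha₃ hd₃
  have hu0 := hu ▸ pairUpper_nonneg ha₂ hd₂ ha₃ hd₃ (hI hy).1 (hI hz).1
  have hu1 := hu ▸ pairUpper_le_pairWidth ha₂ hd₂ ha₃ hd₃ (hI hy).2 (hI hz).2
  have hWu : pairWidth a₂ d₂ a₃ d₃ * (u / pairWidth a₂ d₂ a₃ d₃) = u := by field_simp
  have hx : u / pairWidth a₂ d₂ a₃ d₃ ∈ Icc (0 : ℝ) 1 :=
    ⟨by positivity, by rwa [div_le_one hW]⟩
  refine boxPt_mem_extremePoints hd₁ hd₂ hd₃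
    (upper_boxPt_mem_polytopeP1 ha₁ hd₁ ha₂ hd₂ ha₃ hd₃ hx (hI hy) (hI hz) ?_) ?_
  · rw [upperP1, hu, hWu, min_self]
  intro s t f₁ x₁ y₁ z₁ f₂ x₂ y₂ z₂ hs ht hst h₁ h₂ ef ex ey ez
  rw [boxPt_mem_polytopeP1_iff ha₁ hd₁ ha₂ hd₂ ha₃ hd₃] at h₁ h₂
  obtain ⟨rfl, rfl⟩ := eq_of_combo_of_endpoint hs ht hst ey h₁.2.1 h₂.2.1 hy
  obtain ⟨rfl, rfl⟩ := eq_of_combo_of_endpoint hs ht hst ez h₁.2.2.1 h₂.2.2.1 hz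
  have k₁ := h₁.2.2.2.2
  have k₂ := h₂.2.2.2.2
  rw [upperP1, hu] at k₁ k₂
  generalize pairWidth a₂ d₂ a₃ d₃ = W at *
  have m₁ := mul_le_mul_of_nonneg_left (min_le_left u (W * x₁)) hd₁.le
  have n₁ := mul_le_mul_of_nonneg_left (min_le_right u (W * x₁)) hd₁.le
  have m₂ := mul_le_mul_of_nonneg_left (min_le_left u (W * x₂)) hd₁.le
  have n₂ := mul_le_mul_of_nonneg_left (min_le_right u (W * x₂)) hd₁.le
  have hst' : t + s = 1 := by linarith
  have c : s * (f₁ - d₁ * (a₂ * a₃) * x₁) + t * (f₂ - d₁ * (a₂ * a₃) * x₂) =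
      a₁ * (a₂ * a₃) + a₁ * u + d₁ * u := by linear_combination ef - d₁ * (a₂ * a₃) * ex
  have g₁ := eq_of_combo_of_le hs ht hst c (by linarith) (by linarith)
  have g₂ := eq_of_combo_of_le ht hs hst' ((add_comm _ _).trans c) (by linarith) (by linarith)
  have r₁ : u / W ≤ x₁ := by
    rw [div_le_iff₀' hW]
    exact le_of_mul_le_mul_left (by linarith) hd₁
  have r₂ : u / W ≤ x₂ := by
    rw [div_le_iff₀' hW]
    exact le_of_mul_le_mul_left (by linarith) hd₁
  have hx₁ := eq_of_combo_of_ge hs ht hst ex r₁ r₂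
  refine ⟨?_, hx₁, rfl, rfl⟩
  rw [← hx₁]
  linarith

theorem lower_edge_mem_extremePoints (ha₁ : 0 ≤ a₁) (hd₁ : 0 < d₁) (ha₂ : 0 ≤ a₂) (hd₂ : 0 < d₂)
    (ha₃ : 0 ≤ a₃) (hd₃ : 0 < d₃) {l m y z : ℝ} (hy : y = 0 ∨ y = 1) (hz : z = 0 ∨ z = 1)
    (hl : pairLower a₂ d₂ a₃ d₃ y z = l) (hlu : pairUpper a₂ d₂ a₃ d₃ y z = l)
    (hm : l + m = pairWidth a₂ d₂ a₃ d₃) :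
    boxPt a₁ d₁ a₂ d₂ a₃ d₃ (a₁ * (a₂ * a₃) + d₁ * (a₂ * a₃) * (m / pairWidth a₂ d₂ a₃ d₃) +
      a₁ * l) (m / pairWidth a₂ d₂ a₃ d₃) y z ∈
      (polytopeP1 a₁ (a₁ + d₁) a₂ (a₂ + d₂) a₃ (a₃ + d₃)).extremePoints ℝ := by
  have hI : ∀ {t : ℝ}, t = 0 ∨ t = 1 → t ∈ Icc (0 : ℝ) 1 := by
    rintro t (rfl | rfl) <;> simp
  have hW := pairWidth_pos ha₂ hd₂ ha₃ hd₃
  have hl0 := hlu ▸ pairUpper_nonneg ha₂ hd₂ ha₃ hd₃ (hI hy).1 (hI hz).1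
  have hl1 := hlu ▸ pairUpper_le_pairWidth ha₂ hd₂ ha₃ hd₃ (hI hy).2 (hI hz).2
  have hm0 : 0 ≤ m := by linarith
  have hWm : pairWidth a₂ d₂ a₃ d₃ * (m / pairWidth a₂ d₂ a₃ d₃) = m := by field_simp
  have hx : m / pairWidth a₂ d₂ a₃ d₃ ∈ Icc (0 : ℝ) 1 :=
    ⟨by positivity, by rw [div_le_one hW]; linarith⟩
  refine boxPt_mem_extremePoints hd₁ hd₂ hd₃
    (lower_boxPt_mem_polytopeP1 ha₁ hd₁ ha₂ hd₂ ha₃ hd₃ hx (hI hy) (hI hz) ?_) ?_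
  · rw [lowerP1, hl, mul_sub, hWm, ← hm, max_eq_left (by linarith)]
    ring
  intro s t f₁ x₁ y₁ z₁ f₂ x₂ y₂ z₂ hs ht hst h₁ h₂ ef ex ey ez
  rw [boxPt_mem_polytopeP1_iff ha₁ hd₁ ha₂ hd₂ ha₃ hd₃] at h₁ h₂
  obtain ⟨rfl, rfl⟩ := eq_of_combo_of_endpoint hs ht hst ey h₁.2.1 h₂.2.1 hy
  obtain ⟨rfl, rfl⟩ := eq_of_combo_of_endpoint hs ht hst ez h₁.2.2.1 h₂.2.2.1 hz
  have k₁ := h₁.2.2.2.1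
  have k₂ := h₂.2.2.2.1
  rw [lowerP1, hl] at k₁ k₂
  generalize pairWidth a₂ d₂ a₃ d₃ = W at *
  have m₁ := mul_le_mul_of_nonneg_left (le_max_left 0 (l - W * (1 - x₁))) hd₁.le
  have n₁ := mul_le_mul_of_nonneg_left (le_max_right 0 (l - W * (1 - x₁))) hd₁.le
  have m₂ := mul_le_mul_of_nonneg_left (le_max_left 0 (l - W * (1 - x₂))) hd₁.le
  have n₂ := mul_le_mul_of_nonneg_left (le_max_right 0 (l - W * (1 - x₂))) hd₁.le
  have hst' : t + s = 1 := by linarith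
  have c : s * (f₁ - d₁ * (a₂ * a₃) * x₁) + t * (f₂ - d₁ * (a₂ * a₃) * x₂) =
      a₁ * (a₂ * a₃) + a₁ * l := by linear_combination ef - d₁ * (a₂ * a₃) * ex
  have g₁ := eq_of_combo_of_ge hs ht hst c (by linarith) (by linarith)
  have g₂ := eq_of_combo_of_ge ht hs hst' ((add_comm _ _).trans c) (by linarith) (by linarith)
  have r₁ : x₁ ≤ m / W := by
    rw [le_div_iff₀' hW]
    have : l - W * (1 - x₁) ≤ 0 := le_of_mul_le_mul_left (by linarith) hd₁
    linarith
  have r₂ : x₂ ≤ m / W := by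
    rw [le_div_iff₀' hW]
    have : l - W * (1 - x₂) ≤ 0 := le_of_mul_le_mul_left (by linarith) hd₁
    linarith
  have hx₁ := eq_of_combo_of_le hs ht hst ex r₁ r₂
  refine ⟨?_, hx₁, rfl, rfl⟩
  rw [← hx₁]
  linarith

theorem extremePoints_polytopeP1 (ha₁ : 0 ≤ a₁) (hd₁ : 0 < d₁) (ha₂ : 0 ≤ a₂) (hd₂ : 0 < d₂)
    (ha₃ : 0 ≤ a₃) (hd₃ : 0 < d₃) :
    (polytopeP1 a₁ (a₁ + d₁) a₂ (a₂ + d₂) a₃ (a₃ + d₃)).extremePoints ℝ =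
      boxPoints a₁ (a₁ + d₁) a₂ (a₂ + d₂) a₃ (a₃ + d₃) ∪
        extraPoints1 a₁ (a₁ + d₁) a₂ (a₂ + d₂) a₃ (a₃ + d₃) := by
  have hW := pairWidth_pos ha₂ hd₂ ha₃ hd₃
  have hV : boxPoints a₁ (a₁ + d₁) a₂ (a₂ + d₂) a₃ (a₃ + d₃) ∪
        extraPoints1 a₁ (a₁ + d₁) a₂ (a₂ + d₂) a₃ (a₃ + d₃) ⊆
      (polytopeP1 a₁ (a₁ + d₁) a₂ (a₂ + d₂) a₃ (a₃ + d₃)).extremePoints ℝ := by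
    have hWe : pairWidth a₂ d₂ a₃ d₃ = a₃ * d₂ + a₂ * d₃ + d₂ * d₃ := by unfold pairWidth; ring
    have p1 : 0 ≤ a₂ * d₃ := by positivity
    have p2 : 0 ≤ a₃ * d₂ := by positivity
    have p3 : 0 ≤ d₂ * d₃ := by positivity
    rw [boxPoints_eq, extraPoints1_eq _ _ _ _ _ _ hW.ne']
    simp only [union_subset_iff, insert_subset_iff, singleton_subset_iff]
    refine ⟨⟨?_, ?_, ?_, ?_, ?_, ?_, ?_, ?_⟩, ?_, ?_, ?_, ?_⟩
    rotate_right 4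
    · exact upper_edge_mem_extremePoints ha₁ hd₁ ha₂ hd₂ ha₃ hd₃ (by simp) (by simp)
        (by simp [pairUpper])
    · exact upper_edge_mem_extremePoints ha₁ hd₁ ha₂ hd₂ ha₃ hd₃ (by simp) (by simp)
        (by simp [pairUpper])
    · exact lower_edge_mem_extremePoints ha₁ hd₁ ha₂ hd₂ ha₃ hd₃ (by simp) (by simp)
        (by simp [pairLower]) (by simp [pairUpper]) (by rw [hWe]; ring)
    · exact lower_edge_mem_extremePoints ha₁ hd₁ ha₂ hd₂ ha₃ hd₃ (by simp) (by simp)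
        (by simp [pairLower]) (by simp [pairUpper]) (by rw [hWe]; ring)
    · exact corner_one_mem_extremePoints ha₁ hd₁ ha₂ hd₂ ha₃ hd₃ (by simp) (by simp)
        (by simp [pairLower]) (by simp [pairUpper])
    · exact corner_zero_mem_extremePoints ha₁ hd₁ ha₂ hd₂ ha₃ hd₃ (by simp) (by simp)
        (by simp [pairLower]) (by simp [pairUpper])
    · exact corner_zero_mem_extremePoints ha₁ hd₁ ha₂ hd₂ ha₃ hd₃ (by simp) (by simp)
        (by simp [pairLower]) (by simp [pairUpper])
    · exact corner_zero_mem_extremePoints ha₁ hd₁ ha₂ hd₂ ha₃ hd₃ (by simp) (by simp)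
        (by simp [pairLower]) (by simp [pairUpper])
    · exact corner_zero_mem_extremePoints ha₁ hd₁ ha₂ hd₂ ha₃ hd₃ (by simp) (by simp)
        (by simp [pairLower, hWe]) (by simp [pairUpper, hWe])
    · exact corner_one_mem_extremePoints ha₁ hd₁ ha₂ hd₂ ha₃ hd₃ (by simp) (by simp)
        (by simp [pairLower, hWe]) (by simp [pairUpper, hWe])
    · exact corner_one_mem_extremePoints ha₁ hd₁ ha₂ hd₂ ha₃ hd₃ (by simp) (by simp)
        (by simp [pairLower]) (by simp [pairUpper])
    · exact corner_one_mem_extremePoints ha₁ hd₁ ha₂ hd₂ ha₃ hd₃ (by simp) (by simp)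
        (by simp [pairLower]) (by simp [pairUpper])
  -- `P₁` equals the hull of the listed points, and the extreme points of a hull lie among its
  -- generators.
  exact Subset.antisymm (fun p hp => extremePoints_convexHull_subset
    (inter_extremePoints_subset_extremePoints_of_subset
      (convexHull_min (hV.trans extremePoints_subset) (convex_polytopeP1 ..))
      ⟨polytopeP1_subset_of_convex ha₁ hd₁ ha₂ hd₂ ha₃ hd₃ (convex_convexHull ℝ _)
        (subset_convexHull ℝ _) hp.1, hp⟩)) hV

end extreme

/-! ### The two volume integrals. -/

section volumes

variable {a₁ d₁ a₂ d₂ a₃ d₃ : ℝ}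

theorem cubeIntegral_min_pairUpper (ha₂ : 0 ≤ a₂) (hd₂ : 0 < d₂) (ha₃ : 0 ≤ a₃) (hd₃ : 0 < d₃) :
    cubeIntegral (fun x y z =>
        min (pairUpper a₂ d₂ a₃ d₃ y z) (pairWidth a₂ d₂ a₃ d₃ * x)) =
      (a₃ * d₂ + a₂ * d₃) / 2 + d₂ * d₃ / 3 -
        ((a₃ * d₂) ^ 2 / 3 + (a₂ * d₃) ^ 2 / 3 + (a₃ * d₂) * (a₂ * d₃) / 2 + (d₂ * d₃) ^ 2 / 6 +
          (d₂ * d₃) * (a₃ * d₂ + a₂ * d₃) * 5 / 12) / (2 * pairWidth a₂ d₂ a₃ d₃) := by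
  have hW := pairWidth_pos ha₂ hd₂ ha₃ hd₃
  refine cubeIntegral_of_inner (G := fun y z => 1 * pairUpper a₂ d₂ a₃ d₃ y z +
    -(1 / (2 * pairWidth a₂ d₂ a₃ d₃)) * pairUpper a₂ d₂ a₃ d₃ y z ^ 2) ?_
    (fun y hy => integral_min_quadratic hy (a₃ * d₂) (a₂ * d₃) (d₂ * d₃) 1
      (-(1 / (2 * pairWidth a₂ d₂ a₃ d₃)))) ?_
  · intro y hy z hz
    rw [integral_min_mul hW (pairUpper_nonneg ha₂ hd₂ ha₃ hd₃ hy.1 hz.1)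
      (pairUpper_le_pairWidth ha₂ hd₂ ha₃ hd₃ hy.2 hz.2)]
    ring
  · generalize a₃ * d₂ = r
    generalize a₂ * d₃ = s
    generalize d₂ * d₃ = k
    set n := 1 / (2 * pairWidth a₂ d₂ a₃ d₃) with hn
    -- The coefficients are those of the inner integral expanded in powers of `y`.
    rw [integral_unit_of_eq_quartic (s / 2 - n * s ^ 2 / 3) (r + k - n * (r * s + k * s))
      (-k / 2 - n * (r ^ 2 + k ^ 2 + 2 * k * r)) (n * (2 * k ^ 2 / 3 + k * r + k * s / 3)) 0
      (fun t _ => by ring), hn]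
    ring

theorem cubeIntegral_max_pairLower (ha₂ : 0 ≤ a₂) (hd₂ : 0 < d₂) (ha₃ : 0 ≤ a₃) (hd₃ : 0 < d₃) :
    cubeIntegral (fun x y z =>
        max 0 (pairLower a₂ d₂ a₃ d₃ y z - pairWidth a₂ d₂ a₃ d₃ * (1 - x))) =
      ((a₃ * d₂) ^ 2 / 3 + (a₂ * d₃) ^ 2 / 3 + (a₃ * d₂) * (a₂ * d₃) / 2 + (d₂ * d₃) ^ 2 / 12 +
          (d₂ * d₃) * (a₃ * d₂ + a₂ * d₃) / 4) / (2 * pairWidth a₂ d₂ a₃ d₃) := by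
  have hW := pairWidth_pos ha₂ hd₂ ha₃ hd₃
  refine cubeIntegral_of_inner (G := fun y z => 0 * pairLower a₂ d₂ a₃ d₃ y z +
    1 / (2 * pairWidth a₂ d₂ a₃ d₃) * pairLower a₂ d₂ a₃ d₃ y z ^ 2) ?_
    (fun y hy => integral_max_quadratic hy (a₃ * d₂) (a₂ * d₃) (d₂ * d₃) 0
      (1 / (2 * pairWidth a₂ d₂ a₃ d₃))) ?_
  · intro y hy z hz
    rw [integral_max_sub_mul hW (pairLower_nonneg ha₂ hd₂ ha₃ hd₃ hy.1 hz.1)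
      ((pairLower_le_pairUpper hd₂ hd₃ hy hz).trans
        (pairUpper_le_pairWidth ha₂ hd₂ ha₃ hd₃ hy.2 hz.2))]
    ring
  · generalize a₃ * d₂ = r
    generalize a₂ * d₃ = s
    generalize d₂ * d₃ = k
    set n := 1 / (2 * pairWidth a₂ d₂ a₃ d₃) with hn
    rw [integral_unit_of_eq_quartic (n * s ^ 2 / 3) (n * (r * s))
      (n * (r ^ 2 + k * s)) (n * (k ^ 2 / 3 + k * r - k * s / 3)) 0
      (fun t _ => by ring), hn]
    ring

theorem continuous_upperP1 : Continuous fun q : ℝ × ℝ × ℝ =>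
    upperP1 a₁ d₁ a₂ d₂ a₃ d₃ q.1 q.2.1 q.2.2 := by
  unfold upperP1 pairUpper; fun_prop

theorem continuous_lowerP1 : Continuous fun q : ℝ × ℝ × ℝ =>
    lowerP1 a₁ d₁ a₂ d₂ a₃ d₃ q.1 q.2.1 q.2.2 := by
  unfold lowerP1 pairLower; fun_prop

theorem continuous_upperH : Continuous fun q : ℝ × ℝ × ℝ =>
    upperH a₁ d₁ a₂ d₂ a₃ d₃ q.1 q.2.1 q.2.2 := by
  unfold upperH; fun_prop

theorem continuous_lowerH : Continuous fun q : ℝ × ℝ × ℝ =>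
    lowerH a₁ d₁ a₂ d₂ a₃ d₃ q.1 q.2.1 q.2.2 := by
  unfold lowerH; fun_prop

theorem cubeIntegral_nonneg {F : ℝ → ℝ → ℝ → ℝ}
    (h : ∀ x ∈ Icc (0 : ℝ) 1, ∀ y ∈ Icc (0 : ℝ) 1, ∀ z ∈ Icc (0 : ℝ) 1, 0 ≤ F x y z) :
    0 ≤ cubeIntegral F :=
  intervalIntegral.integral_nonneg zero_le_one fun y hy =>
    intervalIntegral.integral_nonneg zero_le_one fun z hz =>
      intervalIntegral.integral_nonneg zero_le_one fun x hx => h x hx y hy z hz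

/-- In `U - L` the affine terms cancel, which leaves `a₁ d₂ d₃` times the envelope gap of the pair
and `d₁` times the gap of the outer bounds. -/
theorem cubeIntegral_P1 (ha₂ : 0 ≤ a₂) (hd₂ : 0 < d₂) (ha₃ : 0 ≤ a₃) (hd₃ : 0 < d₃) :
    cubeIntegral (fun x y z => upperP1 a₁ d₁ a₂ d₂ a₃ d₃ x y z - lowerP1 a₁ d₁ a₂ d₂ a₃ d₃ x y z) =
      a₁ * d₂ * d₃ / 6 + d₁ * ((a₃ * d₂ + a₂ * d₃) / 2 + d₂ * d₃ / 3 -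
        ((a₃ * d₂) ^ 2 * 2 / 3 + (a₂ * d₃) ^ 2 * 2 / 3 + (a₃ * d₂) * (a₂ * d₃) + (d₂ * d₃) ^ 2 / 4 +
          (d₂ * d₃) * (a₃ * d₂ + a₂ * d₃) * 2 / 3) / (2 * pairWidth a₂ d₂ a₃ d₃)) := by
  have h := cubeIntegral_linear 4 ![a₁ * d₂ * d₃, -(a₁ * d₂ * d₃), d₁, -d₁]
    ![fun _ y z => min y z, fun _ y z => max 0 (y + z - 1),
      fun x y z => min (pairUpper a₂ d₂ a₃ d₃ y z) (pairWidth a₂ d₂ a₃ d₃ * x),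
      fun x y z => max 0 (pairLower a₂ d₂ a₃ d₃ y z - pairWidth a₂ d₂ a₃ d₃ * (1 - x))]
    (by
      intro i
      fin_cases i <;> simp [pairUpper, pairLower] <;> fun_prop)
  simp only [Fin.sum_univ_four] at h
  simp at h
  rw [cubeIntegral_min_yz, cubeIntegral_max_yz, cubeIntegral_min_pairUpper ha₂ hd₂ ha₃ hd₃,
    cubeIntegral_max_pairLower ha₂ hd₂ ha₃ hd₃] at h
  refine (cubeIntegral_congr fun x _ y _ z _ => ?_).trans (h.trans ?_)
  · unfold upperP1 lowerP1
    generalize min (pairUpper a₂ d₂ a₃ d₃ y z) (pairWidth a₂ d₂ a₃ d₃ * x) = M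
    generalize max 0 (pairLower a₂ d₂ a₃ d₃ y z - pairWidth a₂ d₂ a₃ d₃ * (1 - x)) = N
    unfold pairUpper pairLower
    ring
  · ring

theorem cubeIntegral_H :
    cubeIntegral (fun x y z => upperH a₁ d₁ a₂ d₂ a₃ d₃ x y z - lowerH a₁ d₁ a₂ d₂ a₃ d₃ x y z) =
      (d₁ * d₂ * a₃ + d₁ * a₂ * d₃ + a₁ * d₂ * d₃) / 3 + d₁ * d₂ * d₃ / 4 -
      a₁ * d₂ * d₃ * 13 / 24 - (d₁ * a₂ * d₃ - a₁ * d₂ * d₃) / 6 -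
      (d₁ * d₂ * a₃ - a₁ * d₂ * d₃) / 6 - (a₁ * d₂ * d₃ + d₁ * d₂ * d₃) / 24 := by
  have h := cubeIntegral_linear 8 ![d₁ * d₂ * a₃, d₁ * a₂ * d₃, a₁ * d₂ * d₃, d₁ * d₂ * d₃,
      -(a₁ * d₂ * d₃), -(d₁ * a₂ * d₃ - a₁ * d₂ * d₃), -(d₁ * d₂ * a₃ - a₁ * d₂ * d₃),
      -(a₁ * d₂ * d₃ + d₁ * d₂ * d₃)]
    ![fun x y _ => min x y, fun x _ z => min x z, fun _ y z => min y z,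
      fun x y z => min x (min y z), fun x y z => max 0 (x + y + z - 1),
      fun x _ z => max 0 (x + z - 1), fun x y _ => max 0 (x + y - 1),
      fun x y z => max 0 (x + y + z - 2)]
    (by
      intro i
      fin_cases i <;> simp <;> fun_prop)
  simp only [Fin.sum_univ_eight] at h
  simp at h
  rw [cubeIntegral_min_yz, cubeIntegral_min_xy, cubeIntegral_min_xz, cubeIntegral_min_xyz,
    cubeIntegral_max_sub_one, cubeIntegral_max_sub_two, cubeIntegral_max_xy,
    cubeIntegral_max_xz] at h
  refine (cubeIntegral_congr fun x _ y _ z _ => ?_).trans (h.trans ?_)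
  · unfold upperH lowerH
    ring
  · ring

end volumes

theorem theorem2 (a₁ b₁ a₂ b₂ a₃ b₃ : ℝ)
    (ha₁ : 0 ≤ a₁) (hab₁ : a₁ < b₁) (ha₂ : 0 ≤ a₂) (hab₂ : a₂ < b₂) (ha₃ : 0 ≤ a₃) (hab₃ : a₃ < b₃)
    (hΩ₁ : a₁ * b₂ * b₃ + b₁ * a₂ * a₃ ≤ b₁ * a₂ * b₃ + a₁ * b₂ * a₃)
    (hΩ₂ : b₁ * a₂ * b₃ + a₁ * b₂ * a₃ ≤ b₁ * b₂ * a₃ + a₁ * a₂ * b₃) :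
    Set.extremePoints ℝ (polytopeP1 a₁ b₁ a₂ b₂ a₃ b₃) =
        boxPoints a₁ b₁ a₂ b₂ a₃ b₃ ∪ extraPoints1 a₁ b₁ a₂ b₂ a₃ b₃ ∧
      MeasureTheory.volume (polytopeP1 a₁ b₁ a₂ b₂ a₃ b₃) ≠ ⊤ ∧
      MeasureTheory.volume (polytopeH a₁ b₁ a₂ b₂ a₃ b₃) ≠ ⊤ ∧
      (MeasureTheory.volume (polytopeP1 a₁ b₁ a₂ b₂ a₃ b₃)).toReal =
        (MeasureTheory.volume (polytopeH a₁ b₁ a₂ b₂ a₃ b₃)).toReal +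
          (b₁ - a₁) * (b₂ - a₂) ^ 2 * (b₃ - a₃) ^ 2 *
            (3 * (b₁ * b₂ * a₃ - a₁ * b₂ * a₃ + b₁ * a₂ * b₃ - a₁ * a₂ * b₃) +
              2 * (a₁ * b₂ * b₃ - b₁ * a₂ * a₃)) / (24 * (b₂ * b₃ - a₂ * a₃)) := by
  obtain ⟨d₁, rfl⟩ : ∃ d₁, b₁ = a₁ + d₁ := ⟨b₁ - a₁, by ring⟩
  obtain ⟨d₂, rfl⟩ : ∃ d₂, b₂ = a₂ + d₂ := ⟨b₂ - a₂, by ring⟩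
  obtain ⟨d₃, rfl⟩ : ∃ d₃, b₃ = a₃ + d₃ := ⟨b₃ - a₃, by ring⟩
  have hd₁ : 0 < d₁ := by linarith
  have hd₂ : 0 < d₂ := by linarith
  have hd₃ : 0 < d₃ := by linarith
  have hP := volume_between_box hd₁ hd₂ hd₃ _ _ continuous_lowerP1 continuous_upperP1
    (fun x hx y hy z hz => lowerP1_le_upperP1 ha₁ hd₁ ha₂ hd₂ ha₃ hd₃ hx hy hz)
    (boxPt_mem_polytopeP1_iff ha₁ hd₁ ha₂ hd₂ ha₃ hd₃)
  have hH := volume_between_box hd₁ hd₂ hd₃ _ _ continuous_lowerH continuous_upperH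
    (fun x hx y hy z hz => lowerH_le_upperH ha₁ hd₁ ha₂ hd₂ ha₃ hd₃ hx hy hz)
    -- In the `dᵢ`, the two ordering hypotheses read `a₁ d₂ d₃ ≤ d₁ a₂ d₃` and `d₁ a₂ d₃ ≤ d₁ d₂
    -- a₃`; the second side condition is their composite.
    (boxPt_mem_polytopeH_iff ha₁ hd₁ ha₂ hd₂ ha₃ hd₃ (by linarith) (by linarith))
  refine ⟨extremePoints_polytopeP1 ha₁ hd₁ ha₂ hd₂ ha₃ hd₃, ?_, ?_, ?_⟩
  · rw [hP]; exact ENNReal.ofReal_ne_top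
  · rw [hH]; exact ENNReal.ofReal_ne_top
  have hW := pairWidth_pos ha₂ hd₂ ha₃ hd₃
  rw [hP, hH, ENNReal.toReal_ofReal, ENNReal.toReal_ofReal, cubeIntegral_P1 ha₂ hd₂ ha₃ hd₃,
    cubeIntegral_H]
  · have e : (a₂ + d₂) * (a₃ + d₃) - a₂ * a₃ = pairWidth a₂ d₂ a₃ d₃ := rfl
    rw [e]
    field_simp
    unfold pairWidth
    ring
  · exact mul_nonneg (by positivity) (cubeIntegral_nonneg fun x hx y hy z hz =>
      sub_nonneg.2 (lowerH_le_upperH ha₁ hd₁ ha₂ hd₂ ha₃ hd₃ hx hy hz))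
  · exact mul_nonneg (by positivity) (cubeIntegral_nonneg fun x hx y hy z hz =>
      sub_nonneg.2 (lowerP1_le_upperP1 ha₁ hd₁ ha₂ hd₂ ha₃ hd₃ hx hy hz))
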